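/- Let $n\ge 1$ and let $s=(s_1,\dots,s_n)\in(\mathbb{C}^\ast)^n$, $q,t\in\mathbb{C}^\ast$ with $|q|<1$ and $s_j/s_i\notin q^{\mathbb{Z}}$ for $1\le i<j\le n$. Put $z_0=px_1/x_n$ and $z_i=x_{i+1}/x_i$ $(1\le i\le n-1)$, so that $p=z_0z_1\cdots z_{n-1}$, $x_j/x_i=z_i\cdots z_{j-1}$ and $px_i/x_j=z_j\cdots z_{n-1}z_0\cdots z_{i-1}$ for $i<j$. With $\theta(z;p)=\prod_{m\ge0}(1-p^mz)(1-p^{m+1}/z)$, let $$\mathcal{B}_I(x;p)=\prod_{\substack{i<j\\ i\in I,\,j\notin I}}\frac{\theta(x_j/tx_i;p)}{\theta(x_j/x_i;p)}\prod_{\substack{i<j\\ i\notin I,\,j\in I}}\frac{\theta(tx_j/x_i;p)}{\theta(x_j/x_i;p)}\in\mathbb{C}[[z_0,\dots,z_{n-1}]],\qquad I\subseteq\{1,\dots,n\},$$ and let $$\mathcal{E}^{(r)}_{x,s}(p)=\sum_{|I|=r}\Big(\prod_{i\in I}s_i\Big)\,\mathcal{B}_I(x;p)\prod_{i\in I}T_{q,x_i}\qquad(r=1,\dots,n)$$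 be the modified elliptic Ruijsenaars operators, acting on $\mathbb{C}[[z_0,\dots,z_{n-1}]]$, where $T_{q,x_i}$ replaces $x_i$ by $qx_i$. A normalized formal solution consists of $f(x;s;p)=\sum_{k}f_{k_0,\dots,k_{n-1}}z_0^{k_0}\cdots z_{n-1}^{k_{n-1}}\in\mathbb{C}[[z_0,\dots,z_{n-1}]]$ and $\varepsilon^{(r)}(s;p)\in\mathbb{C}[[p]]$ $(r=1,\dots,n)$ such that $$\mathcal{E}^{(r)}_{x,s}(p)f(x;s;p)=\varepsilon^{(r)}(s;p)f(x;s;p)\quad(r=1,\dots,n),\qquad f_{m,\dots,m}=\delta_{m,0}\quad(m\ge0).$$ (1) There is a constant $\sigma\in(0,1)$, depending on $n,s,q,t$ but not on $p$, such that for the normalized formal solution, the series $f(x;s;p)$ converges absolutely for all $p\in\mathbb{C}$ with $|p|<\sigma^n$ and all $x\in(\mathbb{C}^\ast)^n$ with $$|px_1/x_n|<\sigma,\quad |x_2/x_1|<\sigma,\ \dots,\ |x_n/x_{n-1}|<\sigma,$$ and the series $\varepsilon^{(r)}(s;p)$ $(r=1,\dots,n)$ converge absolutely for $|p|<\sigma^n$.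 (2) The convergence is uniform on compact sets of parameters: for every compact set $K$ of parameters $(s,q,t)$ satisfying the above conditions there is $\sigma\in(0,1)$ such that, for every $\rho<\sigma$, the series of absolute values of the terms of $f(x;s;p)$ converges uniformly over $(s,q,t)\in K$, $p\in\mathbb{C}$ and $x\in(\mathbb{C}^\ast)^n$ with $|px_1/x_n|\le\rho$, $|x_{i+1}/x_i|\le\rho$ $(1\le i\le n-1)$; and, for every $\rho<\sigma^n$ and $r=1,\dots,n$, the series of absolute values of the terms of $\varepsilon^{(r)}(s;p)$ converges uniformly over $(s,q,t)\in K$ and $|p|\le\rho$. -/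

import Mathlib

noncomputable section

open scoped MvPowerSeries.WithPiTopology

/-!
Indexing: the position and spectral variables `x_1, …, x_n`, `s_1, …, s_n` are indexed by
`Fin n`, so that `x i` is `x_{i+1}`.  The variables `z_0 = p x_1 / x_n`, `z_1 = x_2 / x_1`, …,
`z_{n-1} = x_n / x_{n-1}` are indexed by `Fin n` as well, with `z_i = x i / x (i - 1)` for `i ≠ 0`.
Addition and subtraction in `Fin n` are cyclic.
-/

namespace Ruijsenaars

/-- The ring `ℂ⟦p x_1/x_n, x_2/x_1, …, x_n/x_{n-1}⟧` of formal power series in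
`z_0, …, z_{n-1}`. -/
abbrev Series (n : ℕ) : Type := MvPowerSeries (Fin n) ℂ

/-- The nome `p = z_0 z_1 ⋯ z_{n-1}` as an element of the ring of formal power series. -/
def nome (n : ℕ) : Series n := ∏ l : Fin n, MvPowerSeries.X l

/-- For `i < j`, the ratio `x j / x i = z_{i+1} ⋯ z_j`. -/
def ratio {n : ℕ} (i j : Fin n) : Series n :=
  ∏ l ∈ Finset.Ioc i j, MvPowerSeries.X l

/-- For `i < j`, the ratio `p x i / x j`, which is the product of the remaining variables. -/
def coratio {n : ℕ} (i j : Fin n) : Series n :=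
  ∏ l ∈ (Finset.Ioc i j)ᶜ, MvPowerSeries.X l

/-- The infinite shifted factorial `(a; p)_∞ = ∏_{m ≥ 0} (1 - p ^ m a)`, where `p` is the
nome. -/
def qPochhammer {n : ℕ} (a : Series n) : Series n :=
  ∏' m : ℕ, (1 - nome n ^ m * a)

/-- The infinite product that defines `qPochhammer` converges. -/
theorem multipliable_qPochhammer {n : ℕ} [NeZero n] (a : Series n) :
    Multipliable fun m : ℕ => (1 - nome n ^ m * a) := by
  have hc : MvPowerSeries.constantCoeff (nome n) = 0 := by
    rw [nome, map_prod]
    exact Finset.prod_eq_zero (Finset.mem_univ (0 : Fin n)) (by simp)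
  have h1 : (1 : ℕ∞) ≤ (nome n).order := by
    rw [Order.one_le_iff_pos, pos_iff_ne_zero]
    intro h
    exact MvPowerSeries.order_ne_zero_iff_constCoeff_eq_zero.2 hc h
  have h2 : ∀ m : ℕ, (m : ℕ∞) ≤ (-(nome n ^ m * a)).order := by
    intro m
    rw [MvPowerSeries.order_neg]
    calc (m : ℕ∞) ≤ m • (nome n).order := by
          rw [nsmul_eq_mul]; exact le_mul_of_one_le_right (zero_le) h1
      _ ≤ (nome n ^ m).order := MvPowerSeries.le_order_pow m
      _ ≤ (nome n ^ m).order + a.order := le_self_add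
      _ ≤ _ := MvPowerSeries.le_order_mul
  simp_rw [sub_eq_add_neg]
  apply MvPowerSeries.WithPiTopology.multipliable_one_add_of_tendsto_order_atTop_nhds_top
  refine tendsto_of_tendsto_of_tendsto_of_le_of_le ?_ tendsto_const_nhds h2 (fun _ => le_top)
  exact ENat.tendsto_nhds_top_iff_natCast_lt.2 fun k =>
    Filter.eventually_atTop.2 ⟨k + 1, fun b hb => by exact_mod_cast hb⟩

/-- The theta function `θ(c x j / x i; p) = (c x j / x i; p)_∞ (c⁻¹ p x i / x j; p)_∞`
for `i < j` and a nonzero constant `c`, as a formal power series. -/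
def theta {n : ℕ} (c : ℂ) (i j : Fin n) : Series n :=
  qPochhammer (MvPowerSeries.C c * ratio i j) * qPochhammer (MvPowerSeries.C c⁻¹ * coratio i j)

/-- The coefficient `B_I(x; p)` of the modified elliptic Ruijsenaars operators. The denominators
are formal power series with constant term `1`. -/
def coeffB {n : ℕ} (t : ℂ) (I : Finset (Fin n)) : Series n :=
  (∏ ij : Fin n × Fin n with ij.1 < ij.2 ∧ ij.1 ∈ I ∧ ij.2 ∉ I,
      theta t⁻¹ ij.1 ij.2 * (theta 1 ij.1 ij.2)⁻¹) *
    ∏ ij : Fin n × Fin n with ij.1 < ij.2 ∧ ij.1 ∉ I ∧ ij.2 ∈ I,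
      theta t ij.1 ij.2 * (theta 1 ij.1 ij.2)⁻¹

/-- The `q`-shift operator `∏_{i ∈ I} T_{q, x i}`.  Replacing `x i` by `q x i` multiplies
`z_i` by `q` and `z_{i+1}` by `q⁻¹`, so that the monomial `z ^ k` is multiplied by
`q ^ (k_i - k_{i+1})`. -/
def qShift {n : ℕ} [NeZero n] (q : ℂ) (I : Finset (Fin n)) (f : Series n) : Series n :=
  fun k => (∏ i ∈ I, q ^ ((k i : ℤ) - (k (i + 1) : ℤ))) * MvPowerSeries.coeff k f

/-- The modified elliptic Ruijsenaars operator of order `r`,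
`∑_{|I| = r} s^I B_I(x; p) T_{q,x}^I`. -/
def modifiedOperator {n : ℕ} [NeZero n] (s : Fin n → ℂ) (q t : ℂ) (r : ℕ) (f : Series n) :
    Series n :=
  ∑ I : Finset (Fin n) with I.card = r,
    MvPowerSeries.C (∏ i ∈ I, s i) * coeffB t I * qShift q I f

/-- A formal power series in `p`, regarded as a formal power series in the variables `z` through
`p = z_0 z_1 ⋯ z_{n-1}`. -/
def ofNome {n : ℕ} [NeZero n] (e : PowerSeries ℂ) : Series n :=
  fun k => if ∀ i, k i = k 0 then PowerSeries.coeff (k 0) e else 0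

/-- `f` is a normalized formal solution of the joint eigenvalue problem for the modified elliptic
Ruijsenaars operators, with formal eigenvalues `ε 1, …, ε n`.  Normalized means that the constant
term of `f` with respect to `x` (the sum over `m` of `p ^ m` times the coefficient of
`(z_0 ⋯ z_{n-1}) ^ m`) is `1`. -/
structure IsNormalizedFormalSolution {n : ℕ} [NeZero n] (s : Fin n → ℂ) (q t : ℂ)
    (f : Series n) (ε : ℕ → PowerSeries ℂ) : Prop where
  eigen : ∀ r ∈ Finset.Icc 1 n, modifiedOperator s q t r f = ofNome (ε r) * f
  normalized : ∀ m : ℕ,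
    MvPowerSeries.coeff (Finsupp.equivFunOnFinite.symm fun _ : Fin n => m) f
      = if m = 0 then 1 else 0

/-- The parameters `(s, q, t)` with `s_i, q, t` nonzero, `|q| < 1` and
`s_j / s_i ∉ q ^ ℤ` for `i < j`. -/
def parameterDomain (n : ℕ) : Set ((Fin n → ℂ) × ℂ × ℂ) :=
  {P | (∀ i, P.1 i ≠ 0) ∧ P.2.1 ≠ 0 ∧ ‖P.2.1‖ < 1 ∧ P.2.2 ≠ 0 ∧
    ∀ i j, i < j → ∀ m : ℤ, P.1 j / P.1 i ≠ P.2.1 ^ m}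

/-- The values `z_0 = p x_1 / x_n`, `z_1 = x_2 / x_1`, …, `z_{n-1} = x_n / x_{n-1}`. -/
def zValue {n : ℕ} [NeZero n] (p : ℂ) (x : Fin n → ℂ) (i : Fin n) : ℂ :=
  (if i = 0 then p else 1) * x i / x (i - 1)

/-- The term of `f(x; p)` with exponent `k`. -/
def term {n : ℕ} [NeZero n] (f : Series n) (p : ℂ) (x : Fin n → ℂ) (k : Fin n →₀ ℕ) : ℂ :=
  MvPowerSeries.coeff k f * ∏ i, zValue p x i ^ k i

end Ruijsenaars

end

/-!
Expand `f` in monomials `z ^ k`. The shifts act diagonally, and the coefficient of `z ^ k` in the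
eigenvalue equations reads `(e_r(s q ^ μ) - e_r(s)) f_k = …`, where `μ_i = k_i - k_{i+1}` and the
right-hand side is bilinear in the lower coefficients of `f`, the series `B_I - 1`, and the
corrections `ε^{(r)} - e_r(s)`, which the normalization in turn expresses linearly through `f`.
Combining these equations over `r` as in Vieta's formula, with `x = s_j` for a `j` with `μ_j ≠ 0`,
yields the coefficient `∏_i (s_j - s_i q ^ {μ_i})` of `f_k`. The negative powers of `q` in it are as
large as those that the shifts produce on the right-hand side, so they cancel, and `f` satisfies a
majorant inequality `F ≪ 1 + κ b (F + F²)` with `b(0) = 0` and `b` convergent. On a polydisc where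
`b` is small this bounds all truncations of `F` by induction on the degree.
-/

noncomputable section

open scoped MvPowerSeries.WithPiTopology

open MvPowerSeries

namespace Ruijsenaars

section WeightedNorm

variable {σ : Type*} {R : Type*} [NormedCommRing R] {w : ℝ}

theorem coeff_rescale_const (c : R) (g : MvPowerSeries σ R) (k : σ →₀ ℕ) :
    coeff k (rescale (fun _ => c) g) = c ^ k.degree * coeff k g := by
  rw [coeff_rescale, Finsupp.prod, Finset.prod_pow_eq_pow_sum, Finsupp.degree_apply]

theorem norm_coeff_mul_mul_pow_le (hw : 0 ≤ w) [DecidableEq σ] (g h : MvPowerSeries σ R)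
    (k : σ →₀ ℕ) :
    ‖coeff k (g * h)‖ * w ^ k.degree ≤ ∑ p ∈ Finset.HasAntidiagonal.antidiagonal k,
      (‖coeff p.1 g‖ * w ^ p.1.degree) * (‖coeff p.2 h‖ * w ^ p.2.degree) := by
  rw [coeff_mul]
  calc _ ≤ (∑ p ∈ Finset.HasAntidiagonal.antidiagonal k, ‖coeff p.1 g‖ * ‖coeff p.2 h‖)
        * w ^ k.degree := by
        gcongr
        exact norm_sum_le_of_le _ fun p _ => norm_mul_le _ _
    _ = _ := by
        rw [Finset.sum_mul]
        refine Finset.sum_congr rfl fun p hp => ?_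
        rw [← Finset.HasAntidiagonal.mem_antidiagonal.1 hp, map_add, pow_add]
        ring

variable [Finite σ]

/-- The exponents of total degree at most `N`. -/
def exponents (σ : Type*) [Finite σ] (N : ℕ) : Finset (σ →₀ ℕ) :=
  (Finsupp.finite_of_degree_le N).toFinset

theorem mem_exponents {N : ℕ} {k : σ →₀ ℕ} : k ∈ exponents σ N ↔ k.degree ≤ N := by
  simp [exponents]

/-- The weighted `ℓ¹` norm `∑ ‖g_k‖ w ^ |k|` of the part of degree at most `N` of a power series.
The truncation makes it finite and hence available in inductive estimates. -/
def weightedNorm (w : ℝ) (N : ℕ) (g : MvPowerSeries σ R) : ℝ :=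
  ∑ k ∈ exponents σ N, ‖coeff k g‖ * w ^ k.degree

theorem weightedNorm_nonneg (hw : 0 ≤ w) (N : ℕ) (g : MvPowerSeries σ R) :
    0 ≤ weightedNorm w N g :=
  Finset.sum_nonneg fun _ _ => by positivity

theorem norm_coeff_mul_pow_le_weightedNorm (hw : 0 ≤ w) {N : ℕ} {k : σ →₀ ℕ}
    (hk : k.degree ≤ N) (g : MvPowerSeries σ R) :
    ‖coeff k g‖ * w ^ k.degree ≤ weightedNorm w N g :=
  Finset.single_le_sum (f := fun k => ‖coeff k g‖ * w ^ k.degree) (fun _ _ => by positivity)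
    (mem_exponents.2 hk)

@[simp]
theorem weightedNorm_zero (w : ℝ) (N : ℕ) : weightedNorm w N (0 : MvPowerSeries σ R) = 0 := by
  simp [weightedNorm]

theorem weightedNorm_neg (w : ℝ) (N : ℕ) (g : MvPowerSeries σ R) :
    weightedNorm w N (-g) = weightedNorm w N g := by
  simp [weightedNorm]

theorem weightedNorm_add_le (hw : 0 ≤ w) (N : ℕ) (g h : MvPowerSeries σ R) :
    weightedNorm w N (g + h) ≤ weightedNorm w N g + weightedNorm w N h := by
  rw [weightedNorm, weightedNorm, weightedNorm, ← Finset.sum_add_distrib]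
  refine Finset.sum_le_sum fun k _ => ?_
  rw [← add_mul, map_add]
  gcongr
  exact norm_add_le _ _

theorem weightedNorm_sum_le (hw : 0 ≤ w) (N : ℕ) {ι : Type*} (S : Finset ι)
    (g : ι → MvPowerSeries σ R) :
    weightedNorm w N (∑ i ∈ S, g i) ≤ ∑ i ∈ S, weightedNorm w N (g i) :=
  Finset.le_sum_of_subadditive _ (weightedNorm_zero w N).le (weightedNorm_add_le hw N) S g

theorem weightedNorm_monomial_le (hw : 0 ≤ w) (N : ℕ) (d : σ →₀ ℕ) (c : R) :
    weightedNorm w N (monomial d c) ≤ ‖c‖ * w ^ d.degree := by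
  classical
  have hterm (k : σ →₀ ℕ) : ‖coeff k (monomial d c)‖ * w ^ k.degree
      = if k = d then ‖c‖ * w ^ d.degree else 0 := by
    rw [coeff_monomial]
    split_ifs with hk
    · rw [hk]
    · simp
  rw [weightedNorm, Finset.sum_congr rfl fun k _ => hterm k, Finset.sum_ite_eq']
  split_ifs
  · exact le_rfl
  · positivity

theorem weightedNorm_C_le (hw : 0 ≤ w) (N : ℕ) (c : R) :
    weightedNorm w N (C c : MvPowerSeries σ R) ≤ ‖c‖ := by
  simpa using weightedNorm_monomial_le hw N (0 : σ →₀ ℕ) c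

theorem weightedNorm_one_le [NormOneClass R] (hw : 0 ≤ w) (N : ℕ) :
    weightedNorm w N (1 : MvPowerSeries σ R) ≤ 1 := by
  simpa using weightedNorm_C_le (σ := σ) hw N (1 : R)

theorem weightedNorm_X_le [NormOneClass R] (hw : 0 ≤ w) (N : ℕ) (l : σ) :
    weightedNorm w N (X l : MvPowerSeries σ R) ≤ w := by
  simpa [X_def, Finsupp.degree_single] using
    weightedNorm_monomial_le hw N (Finsupp.single l 1) (1 : R)

/-- A factor of order at least `a` allows the truncation of the other factor to be lowered by
`a`. -/
theorem weightedNorm_mul_le_of_le_order (hw : 0 ≤ w) (N : ℕ) {a : ℕ} {g : MvPowerSeries σ R}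
    (hg : a ≤ g.order) (h : MvPowerSeries σ R) :
    weightedNorm w (N + a) (g * h) ≤ weightedNorm w (N + a) g * weightedNorm w N h := by
  classical
  let φ (p : (σ →₀ ℕ) × (σ →₀ ℕ)) : ℝ :=
    (‖coeff p.1 g‖ * w ^ p.1.degree) * (‖coeff p.2 h‖ * w ^ p.2.degree)
  have hφ (p) : 0 ≤ φ p := by positivity
  have le_degree {p} (hp : φ p ≠ 0) : a ≤ p.1.degree := by
    by_contra! hlt
    have : coeff p.1 g = 0 := coeff_of_lt_order (lt_of_lt_of_le (by exact_mod_cast hlt) hg)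
    exact hp (by simp [φ, this])
  let Q := exponents σ (N + a) ×ˢ exponents σ N
  have hcoeff {k} (hk : k ∈ exponents σ (N + a)) :
      ‖coeff k (g * h)‖ * w ^ k.degree ≤ ∑ p ∈ Q with p.1 + p.2 = k, φ p := by
    refine (norm_coeff_mul_mul_pow_le hw g h k).trans ?_
    rw [← Finset.sum_filter_ne_zero]
    refine Finset.sum_le_sum_of_subset_of_nonneg (fun p hp => ?_) fun p _ _ => hφ p
    obtain ⟨hpk, hp0⟩ := Finset.mem_filter.1 hp
    rw [Finset.HasAntidiagonal.mem_antidiagonal] at hpk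
    have hle := le_degree hp0
    rw [mem_exponents, ← hpk, map_add] at hk
    simp only [Q, Finset.mem_filter, Finset.mem_product, mem_exponents]
    exact ⟨⟨by omega, by omega⟩, hpk⟩
  calc weightedNorm w (N + a) (g * h)
      ≤ ∑ k ∈ exponents σ (N + a), ∑ p ∈ Q with p.1 + p.2 = k, φ p :=
        Finset.sum_le_sum fun k => hcoeff
    _ ≤ ∑ p ∈ Q, φ p := Finset.sum_fiberwise_le_sum_of_sum_fiber_nonneg fun k _ =>
        Finset.sum_nonneg fun p _ => hφ p
    _ = _ := by rw [weightedNorm, weightedNorm, Finset.sum_mul_sum, Finset.sum_product]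

theorem weightedNorm_mul_le (hw : 0 ≤ w) (N : ℕ) (g h : MvPowerSeries σ R) :
    weightedNorm w N (g * h) ≤ weightedNorm w N g * weightedNorm w N h :=
  weightedNorm_mul_le_of_le_order hw N (a := 0) (by simp) h

theorem weightedNorm_succ_mul_le (hw : 0 ≤ w) (N : ℕ) {g : MvPowerSeries σ R}
    (hg : constantCoeff g = 0) (h : MvPowerSeries σ R) :
    weightedNorm w (N + 1) (g * h) ≤ weightedNorm w (N + 1) g * weightedNorm w N h :=
  weightedNorm_mul_le_of_le_order hw N (by simpa using one_le_order_iff_constCoeff_eq_zero.2 hg) h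

theorem weightedNorm_C_mul_le (hw : 0 ≤ w) (N : ℕ) (c : R) (g : MvPowerSeries σ R) :
    weightedNorm w N (C c * g) ≤ ‖c‖ * weightedNorm w N g :=
  (weightedNorm_mul_le hw N _ g).trans
    (mul_le_mul_of_nonneg_right (weightedNorm_C_le hw N c) (weightedNorm_nonneg hw N g))

theorem weightedNorm_prod_le [NormOneClass R] (hw : 0 ≤ w) (N : ℕ) {ι : Type*} (S : Finset ι)
    (g : ι → MvPowerSeries σ R) :
    weightedNorm w N (∏ i ∈ S, g i) ≤ ∏ i ∈ S, weightedNorm w N (g i) := by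
  classical
  induction S using Finset.induction_on with
  | empty => simpa using weightedNorm_one_le hw N
  | insert i S hi ih =>
    rw [Finset.prod_insert hi, Finset.prod_insert hi]
    exact (weightedNorm_mul_le hw N _ _).trans
      (mul_le_mul_of_nonneg_left ih (weightedNorm_nonneg hw N _))

theorem weightedNorm_prod_le_pow_card [NormOneClass R] (hw : 0 ≤ w) (N : ℕ) {ι : Type*}
    (S : Finset ι) {g : ι → MvPowerSeries σ R} {M : ℝ}
    (hM : ∀ i ∈ S, weightedNorm w N (g i) ≤ M) :
    weightedNorm w N (∏ i ∈ S, g i) ≤ M ^ S.card :=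
  (weightedNorm_prod_le hw N S g).trans
    ((Finset.prod_le_prod (fun _ _ => weightedNorm_nonneg hw N _) hM).trans_eq
      (Finset.prod_const M))

theorem weightedNorm_prod_X_le [NormOneClass R] (hw : 0 ≤ w) (hw' : w ≤ 1) (N : ℕ)
    {S : Finset σ} (hS : S.Nonempty) :
    weightedNorm w N (∏ l ∈ S, X l : MvPowerSeries σ R) ≤ w :=
  (weightedNorm_prod_le_pow_card hw N S fun l _ => weightedNorm_X_le hw N l).trans
    (pow_le_of_le_one hw hw' (Finset.card_pos.2 hS).ne')

theorem weightedNorm_mul_sub_one_le (hw : 0 ≤ w) (N : ℕ) (g h : MvPowerSeries σ R) :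
    weightedNorm w N (g * h - 1) + 1
      ≤ (weightedNorm w N (g - 1) + 1) * (weightedNorm w N (h - 1) + 1) := by
  have hexpand : g * h - 1 = (g - 1) * (h - 1) + ((g - 1) + (h - 1)) := by ring
  rw [hexpand]
  linarith [weightedNorm_add_le hw N ((g - 1) * (h - 1)) ((g - 1) + (h - 1)),
    weightedNorm_add_le hw N (g - 1) (h - 1), weightedNorm_mul_le hw N (g - 1) (h - 1)]

theorem weightedNorm_prod_sub_one_le (hw : 0 ≤ w) (N : ℕ) {ι : Type*} (S : Finset ι)
    (g : ι → MvPowerSeries σ R) :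
    weightedNorm w N (∏ i ∈ S, g i - 1) + 1 ≤ Real.exp (∑ i ∈ S, weightedNorm w N (g i - 1)) := by
  classical
  induction S using Finset.induction_on with
  | empty => simp
  | insert i S hi ih =>
    rw [Finset.prod_insert hi, Finset.sum_insert hi, Real.exp_add]
    have hnonneg := weightedNorm_nonneg hw N (∏ i ∈ S, g i - 1)
    exact (weightedNorm_mul_sub_one_le hw N _ _).trans
      (mul_le_mul (Real.add_one_le_exp _) ih (by linarith) (Real.exp_pos _).le)

theorem weightedNorm_le_sub_one_add_one [NormOneClass R] (hw : 0 ≤ w) (N : ℕ)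
    (g : MvPowerSeries σ R) : weightedNorm w N g ≤ weightedNorm w N (g - 1) + 1 := by
  have hsum := weightedNorm_add_le hw N (g - 1) 1
  rw [sub_add_cancel] at hsum
  linarith [weightedNorm_one_le (σ := σ) (R := R) hw N]

theorem weightedNorm_sub_one_le [NormOneClass R] (hw : 0 ≤ w) (N : ℕ)
    (g : MvPowerSeries σ R) : weightedNorm w N (g - 1) ≤ weightedNorm w N g + 1 := by
  have hsum := weightedNorm_add_le hw N g (-1)
  rw [weightedNorm_neg, ← sub_eq_add_neg] at hsum
  linarith [weightedNorm_one_le (σ := σ) (R := R) hw N]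

theorem weightedNorm_inverse_le [NormOneClass R] (hw : 0 ≤ w) (N : ℕ) {g g' : MvPowerSeries σ R}
    (hg : g * g' = 1) : (1 - weightedNorm w N (g - 1)) * weightedNorm w N g' ≤ 1 := by
  have hg' : g' = 1 + -((g - 1) * g') := by linear_combination hg
  have hsum := weightedNorm_add_le hw N 1 (-((g - 1) * g'))
  rw [← hg', weightedNorm_neg] at hsum
  linarith [weightedNorm_mul_le hw N (g - 1) g', weightedNorm_one_le (σ := σ) (R := R) hw N]

theorem weightedNorm_zero_right (w : ℝ) (g : MvPowerSeries σ R) :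
    weightedNorm w 0 g = ‖constantCoeff g‖ := by
  have hexp : exponents σ 0 = {0} := by ext k; simp [mem_exponents, Finsupp.degree_eq_zero_iff]
  simp [weightedNorm, hexp]

theorem weightedNorm_rescale {c : ℝ} (hc : 0 ≤ c) (w : ℝ) (N : ℕ) (g : MvPowerSeries σ ℝ) :
    weightedNorm w N (rescale (fun _ => c) g) = weightedNorm (c * w) N g := by
  refine Finset.sum_congr rfl fun k _ => ?_
  rw [coeff_rescale_const, norm_mul, norm_pow, Real.norm_of_nonneg hc, mul_pow]
  ring

theorem weightedNorm_mul_left_le {c : ℝ} (hc : 0 ≤ c) (hc' : c ≤ 1) (hw : 0 ≤ w) (N : ℕ)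
    {g : MvPowerSeries σ R} (hg : constantCoeff g = 0) :
    weightedNorm (c * w) N g ≤ c * weightedNorm w N g := by
  rw [weightedNorm, weightedNorm, Finset.mul_sum]
  refine Finset.sum_le_sum fun k _ => ?_
  rcases eq_or_ne k 0 with rfl | hk
  · simp [hg]
  · have hpow : c ^ k.degree ≤ c :=
      pow_le_of_le_one hc hc' (mt (Finsupp.degree_eq_zero_iff k).1 hk)
    calc ‖coeff k g‖ * (c * w) ^ k.degree = c ^ k.degree * (‖coeff k g‖ * w ^ k.degree) := by ring
      _ ≤ c * (‖coeff k g‖ * w ^ k.degree) := by gcongr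

theorem continuous_weightedNorm (w : ℝ) (N : ℕ) :
    Continuous (weightedNorm w N : MvPowerSeries σ R → ℝ) :=
  continuous_finsetSum _ fun k _ =>
    (WithPiTopology.continuous_coeff R k).norm.mul continuous_const

end WeightedNorm

section Theta

theorem constantCoeff_C_mul_prod_X {σ R : Type*} [CommSemiring R] (c : R) {S : Finset σ}
    (hS : S.Nonempty) :
    constantCoeff (C c * ∏ l ∈ S, X l : MvPowerSeries σ R) = 0 := by
  obtain ⟨l, hl⟩ := hS
  rw [map_mul, map_prod, Finset.prod_eq_zero hl (constantCoeff_X l), mul_zero]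

theorem compl_Ioc_nonempty {n : ℕ} (i j : Fin n) : (Finset.Ioc i j)ᶜ.Nonempty :=
  ⟨i, by simp⟩

variable {n : ℕ} [NeZero n] {w : ℝ}

theorem constantCoeff_qPochhammer {a : Series n} (ha : constantCoeff a = 0) :
    constantCoeff (qPochhammer a) = 1 := by
  rw [qPochhammer, (multipliable_qPochhammer a).map_tprod constantCoeff
    (WithPiTopology.continuous_constantCoeff ℂ)]
  simp [ha]

theorem constantCoeff_theta (c : ℂ) {i j : Fin n} (hij : i < j) :
    constantCoeff (theta c i j) = 1 := by
  rw [theta, map_mul, ratio, coratio,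
    constantCoeff_qPochhammer (constantCoeff_C_mul_prod_X _ (Finset.nonempty_Ioc.2 hij)),
    constantCoeff_qPochhammer (constantCoeff_C_mul_prod_X _ (compl_Ioc_nonempty i j)), mul_one]

theorem constantCoeff_prod_theta_div (c : ℂ) {S : Finset (Fin n × Fin n)}
    (hS : ∀ ij ∈ S, ij.1 < ij.2) :
    constantCoeff (∏ ij ∈ S, theta c ij.1 ij.2 * (theta 1 ij.1 ij.2)⁻¹) = 1 := by
  rw [map_prod]
  refine Finset.prod_eq_one fun ij hij => ?_
  rw [map_mul, constantCoeff_inv, constantCoeff_theta _ (hS ij hij),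
    constantCoeff_theta _ (hS ij hij), inv_one, mul_one]

theorem constantCoeff_coeffB (t : ℂ) (I : Finset (Fin n)) :
    constantCoeff (coeffB t I) = 1 := by
  rw [coeffB, map_mul,
    constantCoeff_prod_theta_div _ fun ij hij => (Finset.mem_filter.1 hij).2.1,
    constantCoeff_prod_theta_div _ fun ij hij => (Finset.mem_filter.1 hij).2.1, mul_one]

theorem weightedNorm_nome_pow_mul_le (hw : 0 ≤ w) (hw' : w ≤ 1 / 2) (N m : ℕ)
    (a : Series n) :
    weightedNorm w N (nome n ^ m * a) ≤ (1 / 2) ^ m * weightedNorm w N a := by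
  have hnome : weightedNorm w N (nome n) ≤ 1 / 2 :=
    (weightedNorm_prod_X_le hw (by linarith) N Finset.univ_nonempty).trans hw'
  have hpow : weightedNorm w N (nome n ^ m) ≤ (1 / 2) ^ m := by
    simpa using weightedNorm_prod_le_pow_card hw N (Finset.range m) fun _ _ => hnome
  exact (weightedNorm_mul_le hw N _ a).trans
    (mul_le_mul_of_nonneg_right hpow (weightedNorm_nonneg hw N a))

theorem weightedNorm_qPochhammer_sub_one_le (hw : 0 ≤ w) (hw' : w ≤ 1 / 2) (N : ℕ)
    (a : Series n) :
    weightedNorm w N (qPochhammer a - 1) + 1 ≤ Real.exp (2 * weightedNorm w N a) := by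
  have hlim : Filter.Tendsto
      (fun S : Finset ℕ => weightedNorm w N (∏ m ∈ S, (1 - nome n ^ m * a) - 1) + 1)
      Filter.atTop (nhds (weightedNorm w N (qPochhammer a - 1) + 1)) :=
    ((((continuous_weightedNorm w N).comp (continuous_id.sub continuous_const)).add
      continuous_const).tendsto _).comp (multipliable_qPochhammer a).hasProd
  refine le_of_tendsto' hlim fun S => (weightedNorm_prod_sub_one_le hw N S _).trans ?_
  rw [Real.exp_le_exp]
  calc ∑ m ∈ S, weightedNorm w N (1 - nome n ^ m * a - 1)
      = ∑ m ∈ S, weightedNorm w N (nome n ^ m * a) := by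
        simp only [sub_sub_cancel_left, weightedNorm_neg]
    _ ≤ ∑ m ∈ S, (1 / 2) ^ m * weightedNorm w N a :=
        Finset.sum_le_sum fun m _ => weightedNorm_nome_pow_mul_le hw hw' N m a
    _ = (∑ m ∈ S, (1 / 2 : ℝ) ^ m) * weightedNorm w N a := by rw [Finset.sum_mul]
    _ ≤ 2 * weightedNorm w N a := by
        gcongr
        · exact weightedNorm_nonneg hw N a
        · exact (summable_geometric_two.sum_le_tsum S fun _ _ => by positivity).trans_eq
            tsum_geometric_two

theorem weightedNorm_qPochhammer_C_mul_prod_X_sub_one_le (hw : 0 ≤ w)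
    (hw' : w ≤ 1 / 2) (N : ℕ) (c : ℂ) {S : Finset (Fin n)} (hS : S.Nonempty) :
    weightedNorm w N (qPochhammer (C c * ∏ l ∈ S, X l) - 1) + 1 ≤ Real.exp (2 * (‖c‖ * w)) := by
  refine (weightedNorm_qPochhammer_sub_one_le hw hw' N _).trans ?_
  gcongr
  exact (weightedNorm_C_mul_le hw N c _).trans (mul_le_mul_of_nonneg_left
    (weightedNorm_prod_X_le hw (by linarith) N hS) (norm_nonneg c))

theorem weightedNorm_theta_sub_one_le (hw : 0 ≤ w) (hw' : w ≤ 1 / 2) (N : ℕ) (c : ℂ)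
    {i j : Fin n} (hij : i < j) :
    weightedNorm w N (theta c i j - 1) + 1 ≤ Real.exp (2 * (‖c‖ + ‖c⁻¹‖) * w) := by
  have hratio := weightedNorm_qPochhammer_C_mul_prod_X_sub_one_le hw hw' N c
    (Finset.nonempty_Ioc.2 hij)
  have hcoratio := weightedNorm_qPochhammer_C_mul_prod_X_sub_one_le hw hw' N c⁻¹
    (compl_Ioc_nonempty i j)
  refine (weightedNorm_mul_sub_one_le hw N _ _).trans ((mul_le_mul hratio hcoratio
    (add_nonneg (weightedNorm_nonneg hw N _) zero_le_one) (Real.exp_pos _).le).trans_eq ?_)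
  rw [← Real.exp_add]
  ring_nf

theorem weightedNorm_theta_sub_one_le_third (hw : 0 ≤ w) (hw' : w ≤ 1 / 2) (N : ℕ)
    {c : ℂ} (hc : 8 * (‖c‖ + ‖c⁻¹‖) * w ≤ 1) {i j : Fin n} (hij : i < j) :
    weightedNorm w N (theta c i j - 1) ≤ 1 / 3 := by
  have hexp : Real.exp (2 * (‖c‖ + ‖c⁻¹‖) * w) ≤ 4 / 3 :=
    calc Real.exp (2 * (‖c‖ + ‖c⁻¹‖) * w) ≤ Real.exp (1 / 4) := by gcongr; linarith
      _ ≤ 1 / (1 - 1 / 4) :=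
        Real.exp_bound_div_one_sub_of_interval (by norm_num) (by norm_num)
      _ = 4 / 3 := by norm_num
  linarith [weightedNorm_theta_sub_one_le hw hw' N c hij]

theorem two_le_norm_add_norm_inv {c : ℂ} (hc : c ≠ 0) : 2 ≤ ‖c‖ + ‖c⁻¹‖ := by
  have hpos : 0 < ‖c‖ := norm_pos_iff.2 hc
  have hmul : ‖c‖ * ‖c⁻¹‖ = 1 := by rw [norm_inv, mul_inv_cancel₀ hpos.ne']
  nlinarith [sq_nonneg (‖c‖ - ‖c⁻¹‖), norm_nonneg c⁻¹]

theorem weightedNorm_theta_div_le (hw : 0 ≤ w) (N : ℕ) {c : ℂ} (hc : c ≠ 0)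
    (hcw : 8 * (‖c‖ + ‖c⁻¹‖) * w ≤ 1) {i j : Fin n} (hij : i < j) :
    weightedNorm w N (theta c i j * (theta 1 i j)⁻¹) ≤ 2 := by
  have hw' : 16 * w ≤ 1 := by nlinarith [two_le_norm_add_norm_inv hc]
  have hnum : weightedNorm w N (theta c i j) ≤ 4 / 3 := by
    linarith [weightedNorm_le_sub_one_add_one hw N (theta c i j),
      weightedNorm_theta_sub_one_le_third hw (by linarith) N hcw hij]
  have hden : weightedNorm w N (theta 1 i j)⁻¹ ≤ 3 / 2 := by
    have hunit : theta 1 i j * (theta 1 i j)⁻¹ = 1 :=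
      MvPowerSeries.mul_inv_cancel _ (by simp [constantCoeff_theta _ hij])
    have hone : weightedNorm w N (theta 1 i j - 1) ≤ 1 / 3 :=
      weightedNorm_theta_sub_one_le_third hw (by linarith) N (by norm_num; linarith) hij
    nlinarith [weightedNorm_inverse_le hw N hunit, weightedNorm_nonneg hw N (theta 1 i j)⁻¹]
  calc _ ≤ weightedNorm w N (theta c i j) * weightedNorm w N (theta 1 i j)⁻¹ :=
        weightedNorm_mul_le hw N _ _
    _ ≤ 4 / 3 * (3 / 2) := mul_le_mul hnum hden (weightedNorm_nonneg hw N _) (by norm_num)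
    _ = 2 := by norm_num

theorem weightedNorm_prod_theta_div_le (hw : 0 ≤ w) (N : ℕ) {c : ℂ} (hc : c ≠ 0)
    (hcw : 8 * (‖c‖ + ‖c⁻¹‖) * w ≤ 1) {S : Finset (Fin n × Fin n)}
    (hS : ∀ ij ∈ S, ij.1 < ij.2) :
    weightedNorm w N (∏ ij ∈ S, theta c ij.1 ij.2 * (theta 1 ij.1 ij.2)⁻¹) ≤ 2 ^ n ^ 2 := by
  have hcard : S.card ≤ n ^ 2 := by simpa [sq] using S.card_le_univ
  exact (weightedNorm_prod_le_pow_card hw N S fun ij hij =>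
    weightedNorm_theta_div_le hw N hc hcw (hS ij hij)).trans
      (pow_le_pow_right₀ one_le_two hcard)

theorem weightedNorm_coeffB_le (hw : 0 ≤ w) (N : ℕ) {t : ℂ} (ht : t ≠ 0)
    (htw : 8 * (‖t‖ + ‖t⁻¹‖) * w ≤ 1) (I : Finset (Fin n)) :
    weightedNorm w N (coeffB t I) ≤ 4 ^ n ^ 2 := by
  have htw' : 8 * (‖t⁻¹‖ + ‖t⁻¹⁻¹‖) * w ≤ 1 := by rwa [inv_inv, add_comm ‖t⁻¹‖]
  calc weightedNorm w N (coeffB t I) ≤ 2 ^ n ^ 2 * 2 ^ n ^ 2 :=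
        (weightedNorm_mul_le hw N _ _).trans <| mul_le_mul
          (weightedNorm_prod_theta_div_le hw N (inv_ne_zero ht) htw' fun ij hij =>
            (Finset.mem_filter.1 hij).2.1)
          (weightedNorm_prod_theta_div_le hw N ht htw fun ij hij =>
            (Finset.mem_filter.1 hij).2.1)
          (weightedNorm_nonneg hw N _) (by positivity)
    _ = 4 ^ n ^ 2 := by rw [← mul_pow]; norm_num

end Theta

section Majorant

variable {σ R : Type*} [NormedCommRing R]

/-- The series of the norms of the coefficients. -/
def absSeries (f : MvPowerSeries σ R) : MvPowerSeries σ ℝ := fun k => ‖coeff k f‖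

@[simp]
theorem coeff_absSeries (f : MvPowerSeries σ R) (k : σ →₀ ℕ) :
    coeff k (absSeries f) = ‖coeff k f‖ := rfl

theorem weightedNorm_absSeries [Finite σ] (w : ℝ) (N : ℕ) (f : MvPowerSeries σ R) :
    weightedNorm w N (absSeries f) = weightedNorm w N f := by
  simp only [weightedNorm, coeff_absSeries, norm_norm]

/-- `a` is a majorant of `f` in the sense of Cauchy: it dominates `f` coefficientwise. -/
def IsMajorant (a : MvPowerSeries σ ℝ) (f : MvPowerSeries σ R) : Prop :=
  ∀ k, ‖coeff k f‖ ≤ coeff k a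

theorem isMajorant_absSeries (f : MvPowerSeries σ R) : IsMajorant (absSeries f) f :=
  fun _ => le_rfl

namespace IsMajorant

variable {a b : MvPowerSeries σ ℝ} {f g : MvPowerSeries σ R}

theorem coeff_nonneg (hf : IsMajorant a f) (k : σ →₀ ℕ) : 0 ≤ coeff k a :=
  (norm_nonneg _).trans (hf k)

theorem mul (hf : IsMajorant a f) (hg : IsMajorant b g) : IsMajorant (a * b) (f * g) := by
  classical
  intro k
  rw [coeff_mul, coeff_mul]
  exact norm_sum_le_of_le _ fun p _ => (norm_mul_le _ _).trans
    (mul_le_mul (hf _) (hg _) (norm_nonneg _) (hf.coeff_nonneg _))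

theorem weightedNorm_le [Finite σ] (hf : IsMajorant a f) {w : ℝ} (hw : 0 ≤ w) (N : ℕ) :
    weightedNorm w N f ≤ weightedNorm w N a :=
  Finset.sum_le_sum fun k _ =>
    mul_le_mul_of_nonneg_right ((hf k).trans (le_abs_self _)) (pow_nonneg hw _)

theorem weightedNorm_le_two [Finite σ]
    {κ δ w : ℝ} (hf : IsMajorant (1 + C κ * (b * (absSeries f + absSeries f * absSeries f))) f)
    (hb : constantCoeff b = 0) (hw : 0 ≤ w) (hbδ : ∀ N, weightedNorm w N b ≤ δ) (hκ : 0 ≤ κ)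
    (hκδ : 6 * κ * δ ≤ 1) (N : ℕ) : weightedNorm w N f ≤ 2 := by
  induction N with
  | zero =>
    have hzero : ‖constantCoeff f‖ ≤ 1 := by simpa [hb] using hf 0
    rw [weightedNorm_zero_right]
    linarith
  | succ N ih =>
    set F := absSeries f
    have hF : weightedNorm w N F ≤ 2 := (weightedNorm_absSeries w N f).trans_le ih
    have hFF : weightedNorm w N (F + F * F) ≤ 6 := by
      have hsq := mul_le_mul hF hF (weightedNorm_nonneg hw N F) zero_le_two
      linarith [weightedNorm_add_le hw N F (F * F), weightedNorm_mul_le hw N F F]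
    -- As `b` has no constant term, only the terms of `f` of degree at most `N` enter here.
    have hquad : weightedNorm w (N + 1) (b * (F + F * F)) ≤ δ * 6 :=
      (weightedNorm_succ_mul_le hw N hb _).trans (mul_le_mul (hbδ _) hFF
        (weightedNorm_nonneg hw N _) ((weightedNorm_nonneg hw 0 b).trans (hbδ 0)))
    calc weightedNorm w (N + 1) f ≤ weightedNorm w (N + 1) (1 + C κ * (b * (F + F * F))) :=
          hf.weightedNorm_le hw _
      _ ≤ 1 + κ * weightedNorm w (N + 1) (b * (F + F * F)) :=
          (weightedNorm_add_le hw _ _ _).trans (add_le_add (weightedNorm_one_le hw _)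
            ((weightedNorm_C_mul_le hw _ κ _).trans_eq (by rw [Real.norm_of_nonneg hκ])))
      _ ≤ 1 + κ * (δ * 6) := by gcongr
      _ ≤ 2 := by linarith

end IsMajorant

end Majorant

section Shift

variable {n : ℕ} [NeZero n] {q : ℂ}

/-- The exponent of `q` by which `T_{q, x i}` scales the monomial `z ^ k`. -/
def shiftExponent (k : Fin n →₀ ℕ) (i : Fin n) : ℤ := (k i : ℤ) - (k (i + 1) : ℤ)

/-- The eigenvalue of the `q`-shift operator `∏_{i ∈ I} T_{q, x i}` on the monomial `z ^ k`. -/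
def shiftFactor (q : ℂ) (I : Finset (Fin n)) (k : Fin n →₀ ℕ) : ℂ :=
  ∏ i ∈ I, q ^ shiftExponent k i

/-- A common bound for the eigenvalues of all `q`-shift operators on the monomial `z ^ k`. -/
def shiftScale (q : ℂ) (k : Fin n →₀ ℕ) : ℝ := ∏ i, max 1 (‖q‖ ^ shiftExponent k i)

/-- The exponents of the powers of the nome `p = z_0 ⋯ z_{n-1}`. -/
def IsNomeExponent (k : Fin n →₀ ℕ) : Prop := ∀ i, k i = k 0

theorem coeff_qShift (q : ℂ) (I : Finset (Fin n)) (f : Series n) (k : Fin n →₀ ℕ) :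
    coeff k (qShift q I f) = shiftFactor q I k * coeff k f := rfl

theorem IsNomeExponent.shiftExponent_eq_zero {k : Fin n →₀ ℕ} (hk : IsNomeExponent k)
    (i : Fin n) : shiftExponent k i = 0 := by
  rw [shiftExponent, hk i, hk (i + 1), sub_self]

theorem isNomeExponent_of_shiftExponent_eq_zero {k : Fin n →₀ ℕ}
    (hk : ∀ i, shiftExponent k i = 0) : IsNomeExponent k := by
  have hnat (m : ℕ) : k (Fin.ofNat n m) = k 0 := by
    induction m with
    | zero => simp
    | succ m ih =>
      have hsucc : Fin.ofNat n m + 1 = Fin.ofNat n (m + 1) := by ext; simp [Fin.val_add]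
      have hdiff := hk (Fin.ofNat n m)
      rw [shiftExponent, hsucc] at hdiff
      omega
  exact fun i => by simpa using hnat i

theorem shiftFactor_add (hq : q ≠ 0) (I : Finset (Fin n)) (d e : Fin n →₀ ℕ) :
    shiftFactor q I (d + e) = shiftFactor q I d * shiftFactor q I e := by
  rw [shiftFactor, shiftFactor, shiftFactor, ← Finset.prod_mul_distrib]
  refine Finset.prod_congr rfl fun i _ => ?_
  rw [← zpow_add₀ hq]
  congr 1
  simp only [shiftExponent, Finsupp.add_apply, Nat.cast_add]
  ring

theorem norm_shiftFactor_le_shiftScale (q : ℂ) (I : Finset (Fin n)) (k : Fin n →₀ ℕ) :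
    ‖shiftFactor q I k‖ ≤ shiftScale q k := by
  simp only [shiftFactor, shiftScale, norm_prod, norm_zpow]
  calc ∏ i ∈ I, ‖q‖ ^ shiftExponent k i ≤ ∏ i ∈ I, max 1 (‖q‖ ^ shiftExponent k i) :=
        Finset.prod_le_prod (fun _ _ => by positivity) fun _ _ => le_max_right _ _
    _ ≤ ∏ i, max 1 (‖q‖ ^ shiftExponent k i) :=
        Finset.prod_le_prod_of_subset_of_one_le I.subset_univ (fun _ _ => by positivity)
          fun _ _ _ => le_max_left _ _

theorem one_le_shiftScale (q : ℂ) (k : Fin n →₀ ℕ) : 1 ≤ shiftScale q k :=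
  Finset.one_le_prod fun _ _ => le_max_left _ _

theorem IsNomeExponent.shiftScale_eq_one {k : Fin n →₀ ℕ} (hk : IsNomeExponent k) :
    shiftScale q k = 1 :=
  Finset.prod_eq_one fun i _ => by simp [hk.shiftExponent_eq_zero i]

theorem norm_shiftFactor_inv_le (hq : q ≠ 0) (hq1 : ‖q‖ ≤ 1) (I : Finset (Fin n))
    (d : Fin n →₀ ℕ) : ‖shiftFactor q⁻¹ I d‖ ≤ ‖q‖⁻¹ ^ d.degree := by
  have hinv : 1 ≤ ‖q‖⁻¹ := (one_le_inv₀ (norm_pos_iff.2 hq)).2 hq1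
  calc ‖shiftFactor q⁻¹ I d‖ ≤ ∏ i ∈ I, ‖q‖⁻¹ ^ d i := by
        rw [shiftFactor, norm_prod]
        refine Finset.prod_le_prod (fun _ _ => norm_nonneg _) fun i _ => ?_
        rw [norm_zpow, norm_inv, ← zpow_natCast]
        exact zpow_le_zpow_right₀ hinv (by rw [shiftExponent]; omega)
    _ = ‖q‖⁻¹ ^ ∑ i ∈ I, d i := Finset.prod_pow_eq_pow_sum _ _ _
    _ ≤ ‖q‖⁻¹ ^ d.degree := by
        rw [Finsupp.degree_eq_sum]
        exact pow_le_pow_right₀ hinv (Finset.sum_le_sum_of_subset I.subset_univ)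

theorem qShift_mul (hq : q ≠ 0) (I : Finset (Fin n)) (f g : Series n) :
    qShift q I (f * g) = qShift q I f * qShift q I g := by
  classical
  ext k
  simp only [coeff_qShift, coeff_mul, Finset.mul_sum]
  refine Finset.sum_congr rfl fun p hp => ?_
  rw [← Finset.HasAntidiagonal.mem_antidiagonal.1 hp, shiftFactor_add hq]
  ring

theorem qShift_qShift_inv (hq : q ≠ 0) (I : Finset (Fin n)) (f : Series n) :
    qShift q I (qShift q⁻¹ I f) = f := by
  ext k
  have hcancel : shiftFactor q I k * shiftFactor q⁻¹ I k = 1 := by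
    rw [shiftFactor, shiftFactor, ← Finset.prod_mul_distrib]
    exact Finset.prod_eq_one fun i _ => by
      rw [← mul_zpow, mul_inv_cancel₀ hq, one_zpow]
  rw [coeff_qShift, coeff_qShift, ← mul_assoc, hcancel, one_mul]

theorem isMajorant_qShift_inv (hq : q ≠ 0) (hq1 : ‖q‖ ≤ 1) (I : Finset (Fin n))
    (g : Series n) : IsMajorant (rescale (fun _ => ‖q‖⁻¹) (absSeries g)) (qShift q⁻¹ I g) := by
  intro k
  rw [coeff_qShift, norm_mul, coeff_rescale_const, coeff_absSeries]
  gcongr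
  exact norm_shiftFactor_inv_le hq hq1 I k

/-- Moving the shift off `f` and onto `g` leaves a factor depending only on the total exponent. -/
theorem norm_coeff_mul_qShift_le (hq : q ≠ 0) (hq1 : ‖q‖ ≤ 1) (I : Finset (Fin n))
    (f g : Series n) (k : Fin n →₀ ℕ) :
    ‖coeff k (g * qShift q I f)‖
      ≤ shiftScale q k * coeff k (rescale (fun _ => ‖q‖⁻¹) (absSeries g) * absSeries f) := by
  rw [← qShift_qShift_inv hq I g, ← qShift_mul hq, coeff_qShift, norm_mul, qShift_qShift_inv hq]
  have hmaj := (isMajorant_qShift_inv hq hq1 I g).mul (isMajorant_absSeries f)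
  exact mul_le_mul (norm_shiftFactor_le_shiftScale q I k) (hmaj k) (norm_nonneg _)
    (zero_le_one.trans (one_le_shiftScale q k))

end Shift

section Perturbation

variable {n : ℕ} [NeZero n]

/-- The part of the modified Ruijsenaars operator of order `r` that raises the degree: the
coefficients `B_I` are replaced by `B_I - 1`. -/
def perturbation (s : Fin n → ℂ) (q t : ℂ) (r : ℕ) (f : Series n) : Series n :=
  ∑ I ∈ Finset.univ.powersetCard r, C (∏ i ∈ I, s i) * ((coeffB t I - 1) * qShift q I f)

/-- A common majorant of the nonconstant parts of the coefficients `s^I B_I`, which also absorbs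
the growth of the `q`-shifts. -/
def perturbationMajorant (s : Fin n → ℂ) (q t : ℂ) : MvPowerSeries (Fin n) ℝ :=
  ∑ I : Finset (Fin n),
    C ‖∏ i ∈ I, s i‖ * rescale (fun _ => ‖q‖⁻¹) (absSeries (coeffB t I - 1))

theorem constantCoeff_perturbationMajorant (s : Fin n → ℂ) (q t : ℂ) :
    constantCoeff (perturbationMajorant s q t) = 0 := by
  rw [perturbationMajorant, map_sum]
  refine Finset.sum_eq_zero fun I _ => ?_
  rw [map_mul, ← coeff_zero_eq_constantCoeff_apply (rescale _ _), coeff_rescale_const,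
    coeff_absSeries, coeff_zero_eq_constantCoeff_apply, map_sub, constantCoeff_coeffB]
  simp

theorem coeff_modifiedOperator (s : Fin n → ℂ) (q t : ℂ) (r : ℕ) (f : Series n)
    (k : Fin n →₀ ℕ) :
    coeff k (modifiedOperator s q t r f)
      = (Finset.univ.val.map fun i => s i * q ^ shiftExponent k i).esymm r * coeff k f
        + coeff k (perturbation s q t r f) := by
  rw [modifiedOperator, perturbation, Finset.esymm_map_val, map_sum, map_sum, Finset.sum_mul,
    ← Finset.sum_add_distrib, Finset.univ_filter_card_eq]
  refine Finset.sum_congr rfl fun I _ => ?_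
  rw [mul_assoc, coeff_C_mul, coeff_C_mul, sub_mul, one_mul, map_sub, coeff_qShift,
    Finset.prod_mul_distrib, shiftFactor]
  ring

theorem norm_coeff_perturbation_le {q : ℂ} (hq : q ≠ 0) (hq1 : ‖q‖ ≤ 1) (s : Fin n → ℂ) (t : ℂ)
    (r : ℕ) (f : Series n) (k : Fin n →₀ ℕ) :
    ‖coeff k (perturbation s q t r f)‖
      ≤ shiftScale q k * coeff k (perturbationMajorant s q t * absSeries f) := by
  set c : Finset (Fin n) → ℝ := fun I => ‖∏ i ∈ I, s i‖ * (shiftScale q k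
    * coeff k (rescale (fun _ => ‖q‖⁻¹) (absSeries (coeffB t I - 1)) * absSeries f)) with hc
  have hterm (I : Finset (Fin n)) :
      ‖coeff k (C (∏ i ∈ I, s i) * ((coeffB t I - 1) * qShift q I f))‖ ≤ c I := by
    rw [coeff_C_mul, norm_mul]
    exact mul_le_mul_of_nonneg_left (norm_coeff_mul_qShift_le hq hq1 I f _ k) (norm_nonneg _)
  calc ‖coeff k (perturbation s q t r f)‖ ≤ ∑ I ∈ Finset.univ.powersetCard r, c I := by
        rw [perturbation, map_sum]
        exact norm_sum_le_of_le _ fun I _ => hterm I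
    _ ≤ ∑ I, c I := Finset.sum_le_sum_of_subset_of_nonneg (Finset.subset_univ _)
        fun I _ _ => (norm_nonneg _).trans (hterm I)
    _ = _ := by
        rw [perturbationMajorant, Finset.sum_mul, map_sum, Finset.mul_sum]
        refine Finset.sum_congr rfl fun I _ => ?_
        rw [hc, mul_assoc, coeff_C_mul]
        ring

end Perturbation

section Recursion

theorem prod_sub_eq_sum_esymm {R ι : Type*} [CommRing R] [Fintype ι] (x : R) (y : ι → R) :
    ∏ i, (x - y i) = ∑ r ∈ Finset.range (Fintype.card ι + 1),
      (-1) ^ r * (Finset.univ.val.map y).esymm r * x ^ (Fintype.card ι - r) := by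
  have hvieta := congrArg (Polynomial.eval x)
    (Multiset.prod_X_sub_X_eq_sum_esymm (Finset.univ.val.map y))
  simpa [Polynomial.eval_prod, Polynomial.eval_finsetSum, ← mul_assoc] using hvieta

theorem prod_sub_sub_prod_sub_eq_sum_esymm {R ι : Type*} [CommRing R] [Fintype ι] (x : R)
    (y z : ι → R) :
    ∏ i, (x - y i) - ∏ i, (x - z i) = ∑ r ∈ Finset.Icc 1 (Fintype.card ι),
      (-1) ^ r * x ^ (Fintype.card ι - r)
        * ((Finset.univ.val.map y).esymm r - (Finset.univ.val.map z).esymm r) := by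
  rw [prod_sub_eq_sum_esymm, prod_sub_eq_sum_esymm, ← Finset.sum_sub_distrib, eq_comm]
  refine (Finset.sum_congr rfl fun r _ => by ring).trans
    (Finset.sum_subset (fun r hr => ?_) fun r hr hr' => ?_)
  · rw [Finset.mem_range, Nat.lt_succ_iff]
    exact (Finset.mem_Icc.1 hr).2
  · obtain rfl : r = 0 := by
      simp only [Finset.mem_range, Finset.mem_Icc] at hr hr'
      omega
    simp [Multiset.esymm]

namespace IsNormalizedFormalSolution

variable {n : ℕ} [NeZero n] {s : Fin n → ℂ} {q t : ℂ} {f : Series n} {ε : ℕ → PowerSeries ℂ}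

theorem coeff_eq_coeff_one (H : IsNormalizedFormalSolution s q t f ε) {k : Fin n →₀ ℕ}
    (hk : IsNomeExponent k) : coeff k f = coeff k 1 := by
  classical
  have hconst : k = Finsupp.equivFunOnFinite.symm fun _ : Fin n => k 0 := by
    ext i; simpa using hk i
  have hzero : k = 0 ↔ k 0 = 0 := by
    refine ⟨fun h => by simp [h], fun h => ?_⟩
    ext i; simpa [h] using hk i
  rw [hconst, H.normalized, ← hconst, coeff_one]
  simp only [hzero]

theorem coeff_ofNome_mul (H : IsNormalizedFormalSolution s q t f ε) (e : PowerSeries ℂ)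
    {k : Fin n →₀ ℕ} (hk : IsNomeExponent k) :
    coeff k (ofNome e * f) = coeff k (ofNome e : Series n) := by
  classical
  rw [← mul_one (ofNome e : Series n), mul_assoc, one_mul, coeff_mul, coeff_mul]
  refine Finset.sum_congr rfl fun p hp => ?_
  have hsum := Finset.HasAntidiagonal.mem_antidiagonal.1 hp
  by_cases hfst : IsNomeExponent p.1
  · have hsnd : IsNomeExponent p.2 := fun i => by
      have hi := DFunLike.congr_fun hsum i
      have h0 := DFunLike.congr_fun hsum 0
      simp only [Finsupp.add_apply] at hi h0
      have := hk i
      have := hfst i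
      omega
    rw [H.coeff_eq_coeff_one hsnd]
  · have hvanish : coeff p.1 (ofNome e : Series n) = 0 := if_neg hfst
    rw [hvanish, zero_mul, zero_mul]

theorem coeff_ofNome_eigenvalue (H : IsNormalizedFormalSolution s q t f ε) {r : ℕ}
    (hr : r ∈ Finset.Icc 1 n) {k : Fin n →₀ ℕ} (hk : IsNomeExponent k) :
    coeff k (ofNome (ε r) : Series n)
      = coeff k (C ((Finset.univ.val.map s).esymm r) : Series n)
        + coeff k (perturbation s q t r f) := by
  rw [← H.coeff_ofNome_mul (ε r) hk, ← H.eigen r hr, coeff_modifiedOperator,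
    H.coeff_eq_coeff_one hk, ← coeff_C_mul, mul_one]
  simp only [hk.shiftExponent_eq_zero, zpow_zero, mul_one]

theorem isMajorant_eigenvalue_sub (H : IsNormalizedFormalSolution s q t f ε) (hq : q ≠ 0)
    (hq1 : ‖q‖ ≤ 1) {r : ℕ} (hr : r ∈ Finset.Icc 1 n) :
    IsMajorant (perturbationMajorant s q t * absSeries f)
      (ofNome (ε r) - C ((Finset.univ.val.map s).esymm r) : Series n) := by
  classical
  intro k
  have hpert := norm_coeff_perturbation_le hq hq1 s t r f k
  by_cases hk : IsNomeExponent k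
  · rwa [map_sub, H.coeff_ofNome_eigenvalue hr hk, add_sub_cancel_left,
      ← one_mul (coeff k (_ * _)), ← hk.shiftScale_eq_one (q := q)]
  · have hk0 : k ≠ 0 := by
      rintro rfl
      exact hk fun _ => rfl
    have hvanish : coeff k (ofNome (ε r) : Series n) = 0 := if_neg hk
    rw [map_sub, hvanish, coeff_C, if_neg hk0, sub_zero, norm_zero]
    exact nonneg_of_mul_nonneg_right ((norm_nonneg _).trans hpert)
      (zero_lt_one.trans_le (one_le_shiftScale q k))

theorem norm_esymm_sub_mul_coeff_le (H : IsNormalizedFormalSolution s q t f ε) (hq : q ≠ 0)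
    (hq1 : ‖q‖ ≤ 1) {r : ℕ} (hr : r ∈ Finset.Icc 1 n) (k : Fin n →₀ ℕ) :
    ‖((Finset.univ.val.map fun i => s i * q ^ shiftExponent k i).esymm r
        - (Finset.univ.val.map s).esymm r) * coeff k f‖
      ≤ shiftScale q k * coeff k (perturbationMajorant s q t
          * (absSeries f + absSeries f * absSeries f)) := by
  set Δ : Series n := ofNome (ε r) - C ((Finset.univ.val.map s).esymm r)
  set h := perturbationMajorant s q t * absSeries f
  have hΔf : IsMajorant (h * absSeries f) (Δ * f) :=
    (H.isMajorant_eigenvalue_sub hq hq1 hr).mul (isMajorant_absSeries f)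
  have hident : ((Finset.univ.val.map fun i => s i * q ^ shiftExponent k i).esymm r
      - (Finset.univ.val.map s).esymm r) * coeff k f
      = coeff k (Δ * f) - coeff k (perturbation s q t r f) := by
    rw [sub_mul (ofNome (ε r)), map_sub, ← H.eigen r hr, coeff_modifiedOperator, coeff_C_mul]
    ring
  calc _ ≤ ‖coeff k (Δ * f)‖ + ‖coeff k (perturbation s q t r f)‖ := by
        rw [hident]
        exact norm_sub_le _ _
    _ ≤ shiftScale q k * coeff k (h * absSeries f) + shiftScale q k * coeff k h :=
        add_le_add ((hΔf k).trans (le_mul_of_one_le_left (hΔf.coeff_nonneg k)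
          (one_le_shiftScale q k))) (norm_coeff_perturbation_le hq hq1 s t r f k)
    _ = _ := by
        rw [← mul_add, ← map_add, mul_add, ← mul_assoc, add_comm]

end IsNormalizedFormalSolution

end Recursion

section BoundedParameter

variable {n : ℕ}

/-- Quantitative form of membership in the parameter domain: one constant `A` bounds the sizes of
the parameters and the reciprocals of all the differences that enter the recursion. -/
structure IsBoundedParameter (A : ℝ) (s : Fin n → ℂ) (q t : ℂ) : Prop where
  mem_parameterDomain : (s, q, t) ∈ parameterDomain n
  norm_s_le : ∀ i, ‖s i‖ ≤ A
  norm_q_inv_le : ‖q‖⁻¹ ≤ A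
  norm_t_add_norm_t_inv_le : ‖t‖ + ‖t⁻¹‖ ≤ A
  inv_le_norm_sub : ∀ i j, ∀ m : ℕ, (i = j → m ≠ 0) → A⁻¹ ≤ ‖s j - s i * q ^ m‖

namespace IsBoundedParameter

variable {A : ℝ} {s : Fin n → ℂ} {q t : ℂ}

theorem q_ne_zero (hP : IsBoundedParameter A s q t) : q ≠ 0 := hP.mem_parameterDomain.2.1

theorem norm_q_le_one (hP : IsBoundedParameter A s q t) : ‖q‖ ≤ 1 :=
  hP.mem_parameterDomain.2.2.1.le

theorem t_ne_zero (hP : IsBoundedParameter A s q t) : t ≠ 0 := hP.mem_parameterDomain.2.2.2.1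

theorem one_le (hP : IsBoundedParameter A s q t) : 1 ≤ A :=
  one_le_two.trans ((two_le_norm_add_norm_inv hP.t_ne_zero).trans hP.norm_t_add_norm_t_inv_le)

theorem pos (hP : IsBoundedParameter A s q t) : 0 < A := zero_lt_one.trans_le hP.one_le

theorem norm_prod_s_le (hP : IsBoundedParameter A s q t) (I : Finset (Fin n)) :
    ‖∏ i ∈ I, s i‖ ≤ A ^ n := by
  calc ‖∏ i ∈ I, s i‖ ≤ ∏ _i ∈ I, A := by
        rw [norm_prod]
        exact Finset.prod_le_prod (fun _ _ => norm_nonneg _) fun i _ => hP.norm_s_le i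
    _ = A ^ I.card := Finset.prod_const A
    _ ≤ A ^ n := pow_le_pow_right₀ hP.one_le (card_finset_fin_le I)

theorem norm_esymm_le (hP : IsBoundedParameter A s q t) (r : ℕ) :
    ‖(Finset.univ.val.map s).esymm r‖ ≤ 2 ^ n * A ^ n := by
  have hcard : (Finset.univ.powersetCard r : Finset (Finset (Fin n))).card ≤ 2 ^ n := by
    simpa using Finset.card_le_univ (Finset.univ.powersetCard r : Finset (Finset (Fin n)))
  have hA := hP.pos
  calc ‖(Finset.univ.val.map s).esymm r‖
      ≤ ∑ _I ∈ (Finset.univ : Finset (Fin n)).powersetCard r, A ^ n := by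
        rw [Finset.esymm_map_val]
        exact norm_sum_le_of_le _ fun I _ => hP.norm_prod_s_le I
    _ ≤ 2 ^ n * A ^ n := by
        rw [Finset.sum_const, nsmul_eq_mul]
        gcongr
        exact_mod_cast hcard

theorem inv_mul_max_le_norm_sub (hP : IsBoundedParameter A s q t) {i j : Fin n} {m : ℤ}
    (hm : i = j → m ≠ 0) : A⁻¹ * max 1 (‖q‖ ^ m) ≤ ‖s j - s i * q ^ m‖ := by
  have hq : 0 < ‖q‖ := norm_pos_iff.2 hP.q_ne_zero
  obtain ⟨l, rfl | rfl⟩ := m.eq_nat_or_neg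
  · rw [zpow_natCast, zpow_natCast, max_eq_left (pow_le_one₀ hq.le hP.norm_q_le_one), mul_one]
    exact hP.inv_le_norm_sub i j l fun hij => by simpa using hm hij
  · have hone : 1 ≤ ‖q‖ ^ (-(l : ℤ)) := by
      rw [zpow_neg, zpow_natCast]
      exact (one_le_inv₀ (pow_pos hq l)).2 (pow_le_one₀ hq.le hP.norm_q_le_one)
    have hswap : s j - s i * q ^ (-(l : ℤ)) = -((s i - s j * q ^ l) * q ^ (-(l : ℤ))) := by
      rw [zpow_neg, zpow_natCast, sub_mul,
        mul_inv_cancel_right₀ (pow_ne_zero l hP.q_ne_zero), neg_sub]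
    rw [max_eq_right hone, hswap, norm_neg, norm_mul, norm_zpow]
    gcongr
    exact hP.inv_le_norm_sub j i l fun hji => by simpa using hm hji.symm

variable [NeZero n] {k : Fin n →₀ ℕ}

theorem inv_pow_mul_shiftScale_le_norm_prod_sub (hP : IsBoundedParameter A s q t) {j : Fin n}
    (hj : shiftExponent k j ≠ 0) :
    (A ^ n)⁻¹ * shiftScale q k ≤ ‖∏ i, (s j - s i * q ^ shiftExponent k i)‖ := by
  have hA := hP.pos
  calc (A ^ n)⁻¹ * shiftScale q k = ∏ i, A⁻¹ * max 1 (‖q‖ ^ shiftExponent k i) := by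
        rw [Finset.prod_mul_distrib, shiftScale]
        simp
    _ ≤ ∏ i, ‖s j - s i * q ^ shiftExponent k i‖ :=
        Finset.prod_le_prod (fun _ _ => by positivity) fun i _ =>
          hP.inv_mul_max_le_norm_sub fun hij => hij ▸ hj
    _ = _ := (norm_prod _ _).symm

variable {f : Series n} {ε : ℕ → PowerSeries ℂ}

theorem norm_prod_sub_mul_coeff_le (hP : IsBoundedParameter A s q t)
    (H : IsNormalizedFormalSolution s q t f ε) (j : Fin n) :
    ‖(∏ i, (s j - s i * q ^ shiftExponent k i)) * coeff k f‖
      ≤ n * A ^ n * (shiftScale q k * coeff k (perturbationMajorant s q t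
          * (absSeries f + absSeries f * absSeries f))) := by
  set E := shiftScale q k * coeff k (perturbationMajorant s q t
    * (absSeries f + absSeries f * absSeries f))
  have hA := hP.pos
  have hvanish : ∏ i, (s j - s i) = 0 := Finset.prod_eq_zero (Finset.mem_univ j) (sub_self _)
  have hterm {r : ℕ} (hr : r ∈ Finset.Icc 1 n) :
      ‖(-1) ^ r * s j ^ (n - r)
        * ((Finset.univ.val.map fun i => s i * q ^ shiftExponent k i).esymm r
          - (Finset.univ.val.map s).esymm r) * coeff k f‖ ≤ A ^ n * E := by
    rw [mul_assoc, norm_mul, norm_mul, norm_pow, norm_neg, norm_one, one_pow, one_mul, norm_pow]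
    have hpow : ‖s j‖ ^ (n - r) ≤ A ^ n :=
      (pow_le_pow_left₀ (norm_nonneg _) (hP.norm_s_le j) _).trans
        (pow_le_pow_right₀ hP.one_le (Nat.sub_le n r))
    exact mul_le_mul hpow (H.norm_esymm_sub_mul_coeff_le hP.q_ne_zero hP.norm_q_le_one hr k)
      (norm_nonneg _) (by positivity)
  rw [← sub_zero (∏ i, _), ← hvanish, prod_sub_sub_prod_sub_eq_sum_esymm, Finset.sum_mul]
  simp only [Fintype.card_fin]
  refine (norm_sum_le_of_le _ fun r hr => hterm hr).trans_eq ?_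
  rw [Finset.sum_const, Nat.card_Icc, Nat.add_sub_cancel, nsmul_eq_mul, mul_assoc]

theorem norm_coeff_le_of_shiftExponent_ne_zero (hP : IsBoundedParameter A s q t)
    (H : IsNormalizedFormalSolution s q t f ε) {j : Fin n} (hj : shiftExponent k j ≠ 0) :
    ‖coeff k f‖ ≤ n * A ^ (2 * n) * coeff k (perturbationMajorant s q t
      * (absSeries f + absSeries f * absSeries f)) := by
  have hA := hP.pos
  have hQ : 0 < shiftScale q k := zero_lt_one.trans_le (one_le_shiftScale q k)
  set G := perturbationMajorant s q t * (absSeries f + absSeries f * absSeries f)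
  have hscaled : (A ^ n)⁻¹ * shiftScale q k * ‖coeff k f‖
      ≤ n * A ^ n * (shiftScale q k * coeff k G) := by
    refine le_trans ?_ (hP.norm_prod_sub_mul_coeff_le H j)
    rw [norm_mul]
    gcongr
    exact hP.inv_pow_mul_shiftScale_le_norm_prod_sub hj
  calc ‖coeff k f‖ = A ^ n * (shiftScale q k)⁻¹ *
        ((A ^ n)⁻¹ * shiftScale q k * ‖coeff k f‖) := by field_simp
    _ ≤ A ^ n * (shiftScale q k)⁻¹ * (n * A ^ n * (shiftScale q k * coeff k G)) := by gcongr
    _ = n * A ^ (2 * n) * coeff k G := by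
        rw [two_mul, pow_add]
        field_simp

theorem isMajorant_solution (hP : IsBoundedParameter A s q t)
    (H : IsNormalizedFormalSolution s q t f ε) :
    IsMajorant (1 + C (n * A ^ (2 * n)) * (perturbationMajorant s q t
      * (absSeries f + absSeries f * absSeries f))) f := by
  classical
  intro k
  have hA := hP.pos
  rw [map_add, coeff_C_mul]
  by_cases hk : IsNomeExponent k
  · have hG : 0 ≤ coeff k (perturbationMajorant s q t
        * (absSeries f + absSeries f * absSeries f)) := by
      have hn : (0 : ℝ) < n * A ^ n := by have := Nat.pos_of_neZero n; positivity
      exact nonneg_of_mul_nonneg_right (nonneg_of_mul_nonneg_right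
        ((norm_nonneg _).trans (hP.norm_prod_sub_mul_coeff_le H 0)) hn)
        (zero_lt_one.trans_le (one_le_shiftScale q k))
    have hone : ‖coeff k f‖ = coeff k (1 : MvPowerSeries (Fin n) ℝ) := by
      rw [H.coeff_eq_coeff_one hk, coeff_one, coeff_one]
      split_ifs <;> simp
    rw [hone]
    exact le_add_of_nonneg_right (by positivity)
  · obtain ⟨j, hj⟩ := not_forall.1 (mt isNomeExponent_of_shiftExponent_eq_zero hk)
    have hk0 : k ≠ 0 := by
      rintro rfl
      exact hk fun _ => rfl
    rw [coeff_one, if_neg hk0, zero_add]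
    exact hP.norm_coeff_le_of_shiftExponent_ne_zero H hj

end IsBoundedParameter

end BoundedParameter

section Compactness

open Filter Topology

section Topological

variable {X : Type*} [TopologicalSpace X] {K : Set X}

theorem eventually_forall_norm_le {E : Type*} [SeminormedAddGroup E] (hK : IsCompact K)
    {g : X → E} (hg : ContinuousOn g K) : ∀ᶠ A in atTop, ∀ P ∈ K, ‖g P‖ ≤ A := by
  obtain ⟨B, hB⟩ := hK.exists_bound_of_continuousOn hg
  filter_upwards [eventually_ge_atTop B] with A hA P hP using (hB P hP).trans hA

theorem eventually_forall_inv_le_norm {𝕜 : Type*} [NormedDivisionRing 𝕜] (hK : IsCompact K)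
    {g : X → 𝕜} (hg : ContinuousOn g K) (hg0 : ∀ P ∈ K, g P ≠ 0) :
    ∀ᶠ A in atTop, ∀ P ∈ K, A⁻¹ ≤ ‖g P‖ := by
  filter_upwards [eventually_forall_norm_le hK (hg.inv₀ hg0)] with A hA P hP
  have hinv : ‖g P‖⁻¹ ≤ A := by simpa using hA P hP
  exact inv_le_of_inv_le₀ (norm_pos_iff.2 (hg0 P hP)) hinv

theorem eventually_forall_inv_le_norm_of_tendstoUniformlyOn {𝕜 : Type*} [NormedDivisionRing 𝕜]
    (hK : IsCompact K) {g : ℕ → X → 𝕜} {l : X → 𝕜} (hg : ∀ m, ContinuousOn (g m) K)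
    (hl : ContinuousOn l K) (hl0 : ∀ P ∈ K, l P ≠ 0) (hlim : TendstoUniformlyOn g l atTop K)
    {S : Set ℕ} (hg0 : ∀ m ∈ S, ∀ P ∈ K, g m P ≠ 0) :
    ∀ᶠ A in atTop, ∀ m ∈ S, ∀ P ∈ K, A⁻¹ ≤ ‖g m P‖ := by
  obtain ⟨B, hB, hBpos⟩ :=
    ((eventually_forall_inv_le_norm hK hl hl0).and (eventually_gt_atTop 0)).exists
  obtain ⟨M, hM⟩ := eventually_atTop.1
    (Metric.tendstoUniformlyOn_iff.1 hlim (B⁻¹ / 2) (by positivity))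
  have hinit : ∀ᶠ A in atTop, ∀ m ∈ Finset.range M, m ∈ S → ∀ P ∈ K, A⁻¹ ≤ ‖g m P‖ := by
    rw [eventually_all_finset]
    intro m _
    by_cases hm : m ∈ S
    · filter_upwards [eventually_forall_inv_le_norm hK (hg m) (hg0 m hm)] with A hA _ using hA
    · exact Eventually.of_forall fun A hm' => absurd hm' hm
  filter_upwards [hinit, eventually_ge_atTop (B⁻¹ / 2)⁻¹] with A hA hBA m hm P hP
  rcases lt_or_ge m M with hmM | hmM
  · exact hA m (Finset.mem_range.2 hmM) hm P hP
  · have hdist := hM m hmM P hP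
    rw [dist_eq_norm] at hdist
    have htri := norm_le_norm_add_norm_sub' (l P) (g m P)
    have hlower := hB P hP
    have hAinv : A⁻¹ ≤ B⁻¹ / 2 := inv_le_of_inv_le₀ (by positivity) hBA
    linarith

theorem tendstoUniformlyOn_sub_mul_pow {𝕜 : Type*} [NormedField 𝕜] (hK : IsCompact K)
    {a b q : X → 𝕜} (hb : ContinuousOn b K) (hq : ContinuousOn q K)
    (hq1 : ∀ P ∈ K, ‖q P‖ < 1) :
    TendstoUniformlyOn (fun (m : ℕ) P => a P - b P * q P ^ m) a atTop K := by
  obtain ⟨B, hB⟩ := hK.exists_bound_of_continuousOn hb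
  obtain ⟨c, hc, hcq⟩ := hK.exists_forall_le' (f := fun P => 1 - ‖q P‖) (a := 0)
    (continuousOn_const.sub hq.norm) fun P hP => sub_pos.2 (hq1 P hP)
  have hlim : Tendsto (fun m : ℕ => B * max (1 - c) 0 ^ m) atTop (𝓝 0) := by
    simpa using (tendsto_pow_atTop_nhds_zero_of_lt_one (le_max_right (1 - c) 0)
      (max_lt (by linarith) one_pos)).const_mul B
  refine Metric.tendstoUniformlyOn_iff.2 fun e he => ?_
  filter_upwards [hlim.eventually_lt_const he] with m hm P hP
  rw [dist_eq_norm, sub_sub_cancel, norm_mul, norm_pow]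
  have hqP : ‖q P‖ ≤ max (1 - c) 0 := le_max_of_le_left (by linarith [hcq P hP])
  have hB0 : 0 ≤ B := (norm_nonneg _).trans (hB P hP)
  refine lt_of_le_of_lt ?_ hm
  gcongr
  exact hB P hP

end Topological

variable {n : ℕ} {K : Set ((Fin n → ℂ) × ℂ × ℂ)}

theorem sub_mul_pow_ne_zero {s : Fin n → ℂ} {q t : ℂ} (hP : (s, q, t) ∈ parameterDomain n)
    {i j : Fin n} {m : ℕ} (hm : i = j → m ≠ 0) : s j - s i * q ^ m ≠ 0 := by
  obtain ⟨hs, -, hq1, -, hres⟩ := hP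
  intro hzero
  have hratio : s j / s i = q ^ m := by
    rw [div_eq_iff (hs i), mul_comm]
    exact sub_eq_zero.1 hzero
  rcases lt_trichotomy i j with hij | rfl | hji
  · exact hres i j hij m (by rwa [zpow_natCast])
  · have hnorm := congrArg norm hratio
    rw [div_self (hs i), norm_one, norm_pow] at hnorm
    exact (pow_lt_one₀ (norm_nonneg q) hq1 (hm rfl)).ne' hnorm
  · refine hres j i hji (-m) ?_
    rw [zpow_neg, zpow_natCast, ← hratio, inv_div]

theorem exists_isBoundedParameter (hKD : K ⊆ parameterDomain n) (hK : IsCompact K) :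
    ∃ A : ℝ, ∀ P ∈ K, IsBoundedParameter A P.1 P.2.1 P.2.2 := by
  have hs (i : Fin n) : ContinuousOn (fun P : (Fin n → ℂ) × ℂ × ℂ => P.1 i) K := by fun_prop
  have hq : ContinuousOn (fun P : (Fin n → ℂ) × ℂ × ℂ => P.2.1) K := by fun_prop
  have ht : ContinuousOn (fun P : (Fin n → ℂ) × ℂ × ℂ => P.2.2) K := by fun_prop
  have hs_le : ∀ᶠ A in atTop, ∀ i, ∀ P ∈ K, ‖P.1 i‖ ≤ A :=
    eventually_all.2 fun i => eventually_forall_norm_le hK (hs i)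
  have hq_le := eventually_forall_norm_le hK (hq.inv₀ fun P hP => (hKD hP).2.1)
  have ht_le := eventually_forall_norm_le hK
    (ht.norm.add (ht.inv₀ fun P hP => (hKD hP).2.2.2.1).norm)
  have hsub_ge : ∀ᶠ A in atTop, ∀ i j, ∀ m ∈ {m : ℕ | i = j → m ≠ 0}, ∀ P ∈ K,
      A⁻¹ ≤ ‖P.1 j - P.1 i * P.2.1 ^ m‖ :=
    eventually_all.2 fun i => eventually_all.2 fun j =>
      eventually_forall_inv_le_norm_of_tendstoUniformlyOn hK
        (fun m => (hs j).sub ((hs i).mul (hq.pow m))) (hs j) (fun P hP => (hKD hP).1 j)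
        (tendstoUniformlyOn_sub_mul_pow hK (hs i) hq fun P hP => (hKD hP).2.2.1)
        fun m hm P hP => sub_mul_pow_ne_zero (hKD hP) hm
  obtain ⟨A, hsA, hqA, htA, hsubA⟩ := (hs_le.and (hq_le.and (ht_le.and hsub_ge))).exists
  refine ⟨A, fun P hP => ⟨hKD hP, fun i => hsA i P hP, ?_, ?_,
    fun i j m hm => hsubA i j m hm P hP⟩⟩
  · simpa using hqA P hP
  · exact (Real.le_norm_self _).trans (htA P hP)

end Compactness

section CoefficientBounds

variable {n : ℕ} [NeZero n] {A w : ℝ} {s : Fin n → ℂ} {q t : ℂ}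

namespace IsBoundedParameter

theorem weightedNorm_rescale_coeffB_sub_one_le (hP : IsBoundedParameter A s q t) (hw : 0 ≤ w)
    (hwA : 8 * A ^ 2 * w ≤ 1) (N : ℕ) (I : Finset (Fin n)) :
    weightedNorm w N (rescale (fun _ => ‖q‖⁻¹) (absSeries (coeffB t I - 1)))
      ≤ 8 * A ^ 2 * w * (4 ^ n ^ 2 + 1) := by
  have hA := hP.pos
  set w₀ : ℝ := (8 * A)⁻¹
  set c : ℝ := ‖q‖⁻¹ * (8 * A * w)
  have hw₀ : 0 ≤ w₀ := by positivity
  have hc : 0 ≤ c := by positivity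
  have hcA : c ≤ 8 * A ^ 2 * w := by
    calc c ≤ A * (8 * A * w) := mul_le_mul_of_nonneg_right hP.norm_q_inv_le (by positivity)
      _ = 8 * A ^ 2 * w := by ring
  have hcw : ‖q‖⁻¹ * w = c * w₀ := by
    simp only [c, w₀]
    field_simp
  have htw₀ : 8 * (‖t‖ + ‖t⁻¹‖) * w₀ ≤ 1 := by
    rw [← div_eq_mul_inv, div_le_one (by positivity)]
    exact mul_le_mul_of_nonneg_left hP.norm_t_add_norm_t_inv_le (by norm_num)
  have hconst : constantCoeff (coeffB t I - 1) = 0 := by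
    rw [map_sub, constantCoeff_coeffB, map_one, sub_self]
  calc _ = weightedNorm (c * w₀) N (coeffB t I - 1) := by
        rw [weightedNorm_rescale (inv_nonneg.2 (norm_nonneg q)), weightedNorm_absSeries, hcw]
    _ ≤ c * weightedNorm w₀ N (coeffB t I - 1) :=
        weightedNorm_mul_left_le hc (hcA.trans hwA) hw₀ N hconst
    _ ≤ c * (4 ^ n ^ 2 + 1) := by
        refine mul_le_mul_of_nonneg_left ((weightedNorm_sub_one_le hw₀ N _).trans ?_) hc
        exact add_le_add_left (weightedNorm_coeffB_le hw₀ N hP.t_ne_zero htw₀ I) 1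
    _ ≤ _ := by gcongr

theorem weightedNorm_perturbationMajorant_le (hP : IsBoundedParameter A s q t) (hw : 0 ≤ w)
    (hwA : 8 * A ^ 2 * w ≤ 1) (N : ℕ) :
    weightedNorm w N (perturbationMajorant s q t)
      ≤ 2 ^ n * (A ^ n * (8 * A ^ 2 * w * (4 ^ n ^ 2 + 1))) := by
  have hA := hP.pos
  have hterm (I : Finset (Fin n)) :
      weightedNorm w N (C ‖∏ i ∈ I, s i‖ * rescale (fun _ => ‖q‖⁻¹) (absSeries (coeffB t I - 1)))
        ≤ A ^ n * (8 * A ^ 2 * w * (4 ^ n ^ 2 + 1)) := by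
    refine (weightedNorm_C_mul_le hw N _ _).trans ?_
    rw [norm_norm]
    exact mul_le_mul (hP.norm_prod_s_le I) (hP.weightedNorm_rescale_coeffB_sub_one_le hw hwA N I)
      (weightedNorm_nonneg hw N _) (by positivity)
  refine (weightedNorm_sum_le hw N _ _).trans ((Finset.sum_le_sum fun I _ => hterm I).trans_eq ?_)
  rw [Finset.sum_const, Finset.card_univ, Fintype.card_finset, Fintype.card_fin, nsmul_eq_mul,
    Nat.cast_pow, Nat.cast_ofNat]

variable {f : Series n} {ε : ℕ → PowerSeries ℂ} {δ : ℝ}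

theorem weightedNorm_solution_le (hP : IsBoundedParameter A s q t)
    (H : IsNormalizedFormalSolution s q t f ε) (hw : 0 ≤ w)
    (hδ : ∀ N, weightedNorm w N (perturbationMajorant s q t) ≤ δ)
    (hAδ : 6 * (n * A ^ (2 * n)) * δ ≤ 1) (N : ℕ) : weightedNorm w N f ≤ 2 :=
  (hP.isMajorant_solution H).weightedNorm_le_two (constantCoeff_perturbationMajorant s q t) hw hδ
    (by have := hP.pos; positivity) hAδ N

theorem weightedNorm_eigenvalue_le (hP : IsBoundedParameter A s q t)
    (H : IsNormalizedFormalSolution s q t f ε) (hw : 0 ≤ w)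
    (hδ : ∀ N, weightedNorm w N (perturbationMajorant s q t) ≤ δ)
    (hAδ : 6 * (n * A ^ (2 * n)) * δ ≤ 1) {r : ℕ} (hr : r ∈ Finset.Icc 1 n) (N : ℕ) :
    weightedNorm w N (ofNome (ε r) : Series n) ≤ 2 ^ n * A ^ n + δ * 2 := by
  set e := (Finset.univ.val.map s).esymm r
  have hf := hP.weightedNorm_solution_le H hw hδ hAδ N
  have hδ0 : 0 ≤ δ := (weightedNorm_nonneg hw 0 _).trans (hδ 0)
  have hmaj := H.isMajorant_eigenvalue_sub hP.q_ne_zero hP.norm_q_le_one hr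
  calc weightedNorm w N (ofNome (ε r) : Series n)
      = weightedNorm w N (C e + (ofNome (ε r) - C e) : Series n) := by rw [add_sub_cancel]
    _ ≤ weightedNorm w N (C e : Series n) + weightedNorm w N (ofNome (ε r) - C e : Series n) :=
        weightedNorm_add_le hw N _ _
    _ ≤ 2 ^ n * A ^ n + δ * 2 := by
        refine add_le_add ((weightedNorm_C_le hw N e).trans (hP.norm_esymm_le r))
          ((hmaj.weightedNorm_le hw N).trans ((weightedNorm_mul_le hw N _ _).trans ?_))
        rw [weightedNorm_absSeries]
        exact mul_le_mul (hδ N) hf (weightedNorm_nonneg hw N f) hδ0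

end IsBoundedParameter

theorem norm_coeff_mul_pow_le_weightedNorm_ofNome (hw : 0 ≤ w) (e : PowerSeries ℂ) (m : ℕ) :
    ‖PowerSeries.coeff m e‖ * (w ^ n) ^ m ≤ weightedNorm w (n * m) (ofNome e : Series n) := by
  set k : Fin n →₀ ℕ := Finsupp.equivFunOnFinite.symm fun _ => m with hk
  have hdeg : k.degree = n * m := by simp [hk, Finsupp.degree_eq_sum]
  have hcoeff : coeff k (ofNome e : Series n) = PowerSeries.coeff m e := if_pos fun _ => rfl
  rw [← pow_mul, ← hdeg, ← hcoeff]
  exact norm_coeff_mul_pow_le_weightedNorm hw le_rfl _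

theorem exists_coeff_bound {K : Set ((Fin n → ℂ) × ℂ × ℂ)} (hKD : K ⊆ parameterDomain n)
    (hK : IsCompact K) : ∃ w M : ℝ, 0 < w ∧ w < 1 ∧
      ∀ P ∈ K, ∀ (f : Series n) (ε : ℕ → PowerSeries ℂ),
        IsNormalizedFormalSolution P.1 P.2.1 P.2.2 f ε →
          (∀ k, ‖coeff k f‖ * w ^ k.degree ≤ M) ∧
            ∀ r ∈ Finset.Icc 1 n, ∀ m, ‖PowerSeries.coeff m (ε r)‖ * (w ^ n) ^ m ≤ M := by
  obtain ⟨A, hKA⟩ := exists_isBoundedParameter hKD hK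
  have hsmall (a : ℝ) : ∀ᶠ w : ℝ in nhdsWithin 0 (Set.Ioi 0), a * w < 1 := by
    refine Filter.Tendsto.eventually_lt_const (by norm_num : a * 0 < 1) ?_
    exact ((continuous_const_mul a).tendsto 0).mono_left nhdsWithin_le_nhds
  set D : ℝ := 2 ^ n * (A ^ n * (8 * A ^ 2 * (4 ^ n ^ 2 + 1)))
  obtain ⟨w, hw1, hwA, hwD, hw0⟩ := ((hsmall 1).and ((hsmall (8 * A ^ 2)).and
    ((hsmall (6 * (n * A ^ (2 * n)) * D)).and self_mem_nhdsWithin))).exists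
  refine ⟨w, max 2 (2 ^ n * A ^ n + D * w * 2), hw0, by simpa using hw1,
    fun P hP f ε H => ?_⟩
  have hδ (N : ℕ) : weightedNorm w N (perturbationMajorant P.1 P.2.1 P.2.2) ≤ D * w :=
    ((hKA P hP).weightedNorm_perturbationMajorant_le hw0.le hwA.le N).trans_eq (by ring)
  have hAδ : 6 * (n * A ^ (2 * n)) * (D * w) ≤ 1 := by rw [← mul_assoc]; exact hwD.le
  refine ⟨fun k => ?_, fun r hr m => ?_⟩
  · exact (norm_coeff_mul_pow_le_weightedNorm hw0.le le_rfl f).trans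
      (((hKA P hP).weightedNorm_solution_le H hw0.le hδ hAδ _).trans (le_max_left _ _))
  · exact (norm_coeff_mul_pow_le_weightedNorm_ofNome hw0.le (ε r) m).trans
      (((hKA P hP).weightedNorm_eigenvalue_le H hw0.le hδ hAδ hr _).trans (le_max_right _ _))

end CoefficientBounds

section Summability

theorem summable_pow_degree {σ : Type*} [Finite σ] {x : ℝ} (hx : 0 ≤ x) (hx1 : x < 1) :
    Summable fun k : σ →₀ ℕ => x ^ k.degree := by
  classical
  have := Fintype.ofFinite σ
  have hbox : Summable fun k : σ → ℕ => ∏ i, x ^ k i := by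
    refine summable_of_sum_le (c := ∏ _i : σ, (1 - x)⁻¹)
      (fun k => Finset.prod_nonneg fun _ _ => by positivity) fun S => ?_
    set N : σ → ℕ := S.sup id
    have hS : S ⊆ Fintype.piFinset fun i => Finset.range (N i + 1) := fun k hk =>
      Fintype.mem_piFinset.2 fun i =>
        Finset.mem_range_succ_iff.2 (Finset.le_sup (f := id) hk i)
    calc ∑ k ∈ S, ∏ i, x ^ k i
        ≤ ∑ k ∈ Fintype.piFinset fun i => Finset.range (N i + 1), ∏ i, x ^ k i :=
          Finset.sum_le_sum_of_subset_of_nonneg hS fun k _ _ =>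
            Finset.prod_nonneg fun _ _ => by positivity
      _ = ∏ i, ∑ m ∈ Finset.range (N i + 1), x ^ m := (Finset.prod_univ_sum _ _).symm
      _ ≤ ∏ _i : σ, (1 - x)⁻¹ := by
          refine Finset.prod_le_prod (fun _ _ => by positivity) fun i _ => ?_
          rw [← tsum_geometric_of_lt_one hx hx1]
          exact (summable_geometric_of_lt_one hx hx1).sum_le_tsum _ fun _ _ => by positivity
  refine (Finsupp.equivFunOnFinite.summable_iff.2 hbox).congr fun k => ?_
  simp [Finsupp.degree_eq_sum, Finset.prod_pow_eq_pow_sum]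

variable {β : Type*} {S : Set β} {w M ρ : ℝ}

theorem norm_mul_le_mul_div_pow {R : Type*} [NormedRing R] {c u : R} {d : ℕ} (hw : 0 < w)
    (hρ : 0 ≤ ρ) (hc : ‖c‖ * w ^ d ≤ M) (hu : ‖u‖ ≤ ρ ^ d) : ‖c * u‖ ≤ M * (ρ / w) ^ d :=
  calc ‖c * u‖ ≤ ‖c‖ * ρ ^ d := (norm_mul_le c u).trans (by gcongr)
    _ = ‖c‖ * w ^ d * (ρ / w) ^ d := by rw [div_pow]; field_simp
    _ ≤ M * (ρ / w) ^ d := by gcongr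

theorem summableUniformlyOn_norm_coeff_mul_prod_pow {σ : Type*} [Fintype σ]
    {F : β → MvPowerSeries σ ℂ} {z : β → σ → ℂ} (hw : 0 < w) (hρ : ρ < w)
    (hF : ∀ b ∈ S, ∀ k, ‖coeff k (F b)‖ * w ^ k.degree ≤ M) (hz : ∀ b ∈ S, ∀ i, ‖z b i‖ ≤ ρ) :
    SummableUniformlyOn (fun (k : σ →₀ ℕ) b => ‖coeff k (F b) * ∏ i, z b i ^ k i‖) S := by
  have hρ0 : 0 ≤ max ρ 0 := le_max_right ρ 0
  have hsum := (summable_pow_degree (σ := σ) (div_nonneg hρ0 hw.le)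
    ((div_lt_one hw).2 (max_lt hρ hw))).mul_left M
  refine (HasSumUniformlyOn.of_norm_le_summable hsum fun k b hb => ?_).summableUniformlyOn
  rw [norm_norm]
  refine norm_mul_le_mul_div_pow hw hρ0 (hF b hb k) ?_
  rw [norm_prod, Finsupp.degree_eq_sum, ← Finset.prod_pow_eq_pow_sum]
  refine Finset.prod_le_prod (fun _ _ => norm_nonneg _) fun i _ => ?_
  rw [norm_pow]
  exact pow_le_pow_left₀ (norm_nonneg _) (le_max_of_le_left (hz b hb i)) _

theorem summableUniformlyOn_norm_coeff_mul_pow {F : β → PowerSeries ℂ} {p : β → ℂ} (hw : 0 < w)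
    (hρ : ρ < w) (hF : ∀ b ∈ S, ∀ m, ‖PowerSeries.coeff m (F b)‖ * w ^ m ≤ M)
    (hp : ∀ b ∈ S, ‖p b‖ ≤ ρ) :
    SummableUniformlyOn (fun (m : ℕ) b => ‖PowerSeries.coeff m (F b) * p b ^ m‖) S := by
  have hρ0 : 0 ≤ max ρ 0 := le_max_right ρ 0
  have hsum := (summable_geometric_of_lt_one (div_nonneg hρ0 hw.le)
    ((div_lt_one hw).2 (max_lt hρ hw))).mul_left M
  refine (HasSumUniformlyOn.of_norm_le_summable hsum fun m b hb => ?_).summableUniformlyOn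
  rw [norm_norm]
  refine norm_mul_le_mul_div_pow hw hρ0 (hF b hb m) ?_
  rw [norm_pow]
  exact pow_le_pow_left₀ (norm_nonneg _) (le_max_of_le_left (hp b hb)) _

end Summability

end Ruijsenaars

end

open Ruijsenaars in
theorem theorem2p6 (n : ℕ) [NeZero n] :
    (∀ (s : Fin n → ℂ) (q t : ℂ), (s, q, t) ∈ parameterDomain n →
      ∃ σ : ℝ, 0 < σ ∧ σ < 1 ∧
        ∀ (f : Series n) (ε : ℕ → PowerSeries ℂ), IsNormalizedFormalSolution s q t f ε →
          (∀ (p : ℂ) (x : Fin n → ℂ), ‖p‖ < σ ^ n → (∀ i, x i ≠ 0) →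
            (∀ i, ‖zValue p x i‖ < σ) →
            Summable fun k : Fin n →₀ ℕ => ‖term f p x k‖) ∧
          (∀ r ∈ Finset.Icc 1 n, ∀ p : ℂ, ‖p‖ < σ ^ n →
            Summable fun k : ℕ => ‖PowerSeries.coeff k (ε r) * p ^ k‖)) ∧
    (∀ K : Set ((Fin n → ℂ) × ℂ × ℂ), K ⊆ parameterDomain n → IsCompact K →
      ∃ σ : ℝ, 0 < σ ∧ σ < 1 ∧
        ∀ (F : (Fin n → ℂ) × ℂ × ℂ → Series n) (E : (Fin n → ℂ) × ℂ × ℂ → ℕ → PowerSeries ℂ),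
          (∀ P ∈ K, IsNormalizedFormalSolution P.1 P.2.1 P.2.2 (F P) (E P)) →
          (∀ ρ : ℝ, ρ < σ →
            SummableUniformlyOn
              (fun (k : Fin n →₀ ℕ) (a : ((Fin n → ℂ) × ℂ × ℂ) × ℂ × (Fin n → ℂ)) =>
                ‖term (F a.1) a.2.1 a.2.2 k‖)
              {a | a.1 ∈ K ∧ (∀ i, a.2.2 i ≠ 0) ∧ ∀ i, ‖zValue a.2.1 a.2.2 i‖ ≤ ρ}) ∧
          (∀ r ∈ Finset.Icc 1 n, ∀ ρ : ℝ, ρ < σ ^ n →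
            SummableUniformlyOn
              (fun (k : ℕ) (a : ((Fin n → ℂ) × ℂ × ℂ) × ℂ) =>
                ‖PowerSeries.coeff k (E a.1 r) * a.2 ^ k‖)
              {a | a.1 ∈ K ∧ ‖a.2‖ ≤ ρ})) := by
  refine ⟨fun s q t hP => ?_, fun K hKD hK => ?_⟩
  · obtain ⟨w, M, hw0, hw1, hbound⟩ :=
      exists_coeff_bound (Set.singleton_subset_iff.2 hP) isCompact_singleton
    refine ⟨w, hw0, hw1, fun f ε H => ?_⟩
    obtain ⟨hf, hε⟩ := hbound (s, q, t) rfl f ε H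
    refine ⟨fun p x _ _ hz => ?_, fun r hr p hp => ?_⟩
    · obtain ⟨i, hi⟩ := Finite.exists_max fun i => ‖zValue p x i‖
      exact (summableUniformlyOn_norm_coeff_mul_prod_pow (S := Set.univ) hw0 (hz i)
        (fun _ _ => hf) fun _ _ => hi).summable (Set.mem_univ ())
    · exact (summableUniformlyOn_norm_coeff_mul_pow (S := Set.univ) (pow_pos hw0 n) hp
        (fun _ _ => hε r hr) fun _ _ => le_rfl).summable (Set.mem_univ ())
  · obtain ⟨w, M, hw0, hw1, hbound⟩ := exists_coeff_bound hKD hK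
    refine ⟨w, hw0, hw1, fun F E H => ⟨fun ρ hρ => ?_, fun r hr ρ hρ => ?_⟩⟩
    · exact summableUniformlyOn_norm_coeff_mul_prod_pow hw0 hρ
        (fun a ha => (hbound a.1 ha.1 _ _ (H a.1 ha.1)).1) fun a ha => ha.2.2
    · exact summableUniformlyOn_norm_coeff_mul_pow (pow_pos hw0 n) hρ
        (fun a ha => (hbound a.1 ha.1 _ _ (H a.1 ha.1)).2 r hr) fun a ha => ha.2
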